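/- Let $\alpha,\beta\in(0,1)$ with $\alpha+\beta<1$, and let $\Lambda=\{\lambda_k\}_{k\ge1}$ be a sequence of positive numbers such that $$\frac{\lambda_k}{k^{1-(\alpha+\beta)}}\downarrow 0,\qquad \sum_{k=1}^\infty\frac{\lambda_k}{k^{2-(\alpha+\beta)}}<\infty .$$ Let $f:\mathbb R^2\to\mathbb R$ be $2\pi$-periodic in each variable, integrable on $[0,2\pi]^2$, and of bounded partial $\Lambda$-variation, i.e. $$\sup_{y}\sup_{\{(a_i,b_i)\}}\sum_i\frac{|f(b_i,y)-f(a_i,y)|}{\lambda_i}+\sup_{x}\sup_{\{(a_j,b_j)\}}\sum_j\frac{|f(x,b_j)-f(x,a_j)|}{\lambda_j}<\infty ,$$ where $x,y$ range over $[0,2\pi]$ and the inner suprema are over all finite families of nonoverlapping intervals in $[0,2\pi]$, indexed by $1,2,\dots,N$ in an arbitrary order. Let $$\widehat f(k,l)=\frac1{4\pi^2}\int_0^{2\pi}\!\!\int_0^{2\pi}f(x,y)e^{-ikx}e^{-ily}\,dx\,dy,\qquad S_{p,q}(x,y)=\sum_{k=-p}^{p}\sum_{l=-q}^{q}\widehat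 f(k,l)e^{ikx}e^{ily},$$ let $A_0^\gamma=1$, $A_k^\gamma=(\gamma+1)\cdots(\gamma+k)/k!$ for $k\ge1$, and let $$\sigma_{n,m}(x,y)=\frac1{A_n^{-\alpha}A_m^{-\beta}}\sum_{p=0}^n\sum_{q=0}^m A_{n-p}^{-\alpha-1}A_{m-q}^{-\beta-1}S_{p,q}(x,y)$$ be the Cesàro $(C;-\alpha,-\beta)$ means of the double Fourier series of $f$. Then: 1. at every point $(x,y)$ at which the four limits $f(x\pm0,y\pm0)$ of $f$ over the open coordinate quadrants with vertex $(x,y)$ exist, $$\lim_{n,m\to\infty}\sigma_{n,m}(x,y)=\tfrac14\bigl(f(x+0,y+0)+f(x+0,y-0)+f(x-0,y+0)+f(x-0,y-0)\bigr),$$ where $n$ and $m$ tend to infinity independently; 2. for every compact $K\subset\mathbb R^2$ such that $f$ is continuous (as a function on $\mathbb R^2$) at every point of $K$, $\sigma_{n,m}\to f$ uniformly on $K$ as $n,m\to\infty$. -/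

import Mathlib

open Set Filter Topology MeasureTheory
open scoped ENNReal

noncomputable section

namespace PartialVariation

/-- The square `[0, 2π]²`. -/
def square : Set (ℝ × ℝ) := Icc 0 (2 * Real.pi) ×ˢ Icc 0 (2 * Real.pi)

/-- `f` has period `2π` with respect to each variable. -/
def Periodic2 (f : ℝ × ℝ → ℝ) : Prop :=
  (∀ x y, f (x + 2 * Real.pi, y) = f (x, y)) ∧ (∀ x y, f (x, y + 2 * Real.pi) = f (x, y))

/-- `(a i, b i)`, `i < N`, are nonoverlapping intervals in `[0, 2π]`; the family is indexed,
so it is ordered in an arbitrary way. -/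
def Nonoverlapping {N : ℕ} (a b : Fin N → ℝ) : Prop :=
  (∀ i, 0 ≤ a i ∧ a i < b i ∧ b i ≤ 2 * Real.pi) ∧
    Pairwise fun i j => Disjoint (Ioo (a i) (b i)) (Ioo (a j) (b j))

/-- The `Λ`-variation on `[0, 2π]` of a function of one variable, for the sequence
`lam 1, lam 2, …` (the term `lam 0` is not used). -/
def lambdaVar (lam : ℕ → ℝ) (g : ℝ → ℝ) : ℝ≥0∞ :=
  ⨆ (N : ℕ) (a : Fin N → ℝ) (b : Fin N → ℝ) (_ : Nonoverlapping a b),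
    ∑ i : Fin N, ENNReal.ofReal (|g (b i) - g (a i)| / lam ((i : ℕ) + 1))

/-- The partial `Λ`-variation in the first variable. -/
def lambdaVar₁ (lam : ℕ → ℝ) (f : ℝ × ℝ → ℝ) : ℝ≥0∞ :=
  ⨆ y ∈ Icc 0 (2 * Real.pi), lambdaVar lam fun x => f (x, y)

/-- The partial `Λ`-variation in the second variable. -/
def lambdaVar₂ (lam : ℕ → ℝ) (f : ℝ × ℝ → ℝ) : ℝ≥0∞ :=
  ⨆ x ∈ Icc 0 (2 * Real.pi), lambdaVar lam fun y => f (x, y)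

/-- `f` has bounded partial `Λ`-variation. -/
def BoundedPartialVar (lam : ℕ → ℝ) (f : ℝ × ℝ → ℝ) : Prop :=
  lambdaVar₁ lam f + lambdaVar₂ lam f < ∞

/-- The double trigonometric Fourier coefficients. -/
def coeff (f : ℝ × ℝ → ℝ) (m n : ℤ) : ℂ :=
  1 / (4 * (Real.pi : ℂ) ^ 2) *
    ∫ p in square, (f p : ℂ) * Complex.exp (-(Complex.I * m * p.1)) *
      Complex.exp (-(Complex.I * n * p.2))

/-- The rectangular partial sums of the double Fourier series. -/
def partialSum (f : ℝ × ℝ → ℝ) (M N : ℕ) (p : ℝ × ℝ) : ℂ :=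
  ∑ m ∈ Finset.Icc (-(M : ℤ)) M, ∑ n ∈ Finset.Icc (-(N : ℤ)) N,
    coeff f m n * Complex.exp (Complex.I * m * p.1) * Complex.exp (Complex.I * n * p.2)

/-- The Cesàro numbers `(γ + 1) ⋯ (γ + k) / k!`. -/
def cesaroNumber (γ : ℝ) (k : ℕ) : ℝ :=
  (∏ i ∈ Finset.Icc 1 k, (γ + i)) / (k.factorial : ℝ)

/-- The Cesàro `(C; γ, δ)` means of the double Fourier series. -/
def cesaroMean (γ δ : ℝ) (f : ℝ × ℝ → ℝ) (n m : ℕ) (p : ℝ × ℝ) : ℂ :=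
  1 / (cesaroNumber γ n : ℂ) * (1 / (cesaroNumber δ m : ℂ)) *
    ∑ i ∈ Finset.range (n + 1), ∑ j ∈ Finset.range (m + 1),
      (cesaroNumber (γ - 1) (n - i) : ℂ) * (cesaroNumber (δ - 1) (m - j) : ℂ) *
        partialSum f i j p

/-- The double Fourier series of `f` is `(C; γ, δ)` summable to `s` at `p`: the means converge
as `n` and `m` tend to infinity independently. -/
def CesaroSummable (γ δ : ℝ) (f : ℝ × ℝ → ℝ) (p : ℝ × ℝ) (s : ℝ) : Prop :=
  Tendsto (fun k : ℕ × ℕ => cesaroMean γ δ f k.1 k.2 p) (atTop ×ˢ atTop) (𝓝 (s : ℂ))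

/-- Uniform `(C; γ, δ)` summability to `f` on `K`. -/
def CesaroSummableUniformlyOn (γ δ : ℝ) (f : ℝ × ℝ → ℝ) (K : Set (ℝ × ℝ)) : Prop :=
  TendstoUniformlyOn (fun (k : ℕ × ℕ) p => cesaroMean γ δ f k.1 k.2 p)
    (fun p => (f p : ℂ)) (atTop ×ˢ atTop) K

end PartialVariation

end

/-!
Subtracting from `f` its limit in each open quadrant with vertex `(x, y)`, the error of the Cesàro
mean becomes a sum of four integrals over `(0, π]²` of a function `φ` of small size near the
vertex, against a product of two one-dimensional kernels. Cut `(0, π]²` into cells of sides `π / n`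
and `π / m` and translate all of them onto one: the integral is the average over `(u, v)` in a
single cell of sums over the grid `(u + kπ / n, v + lπ / m)`. On such a grid the kernel of order
`-α` alternates in sign, so its tail sums satisfy
`|∑ i ≥ k, K (u + iπ / n)| ≤ C n (k + 1) ^ (α - 1)`, and Abel summation in both variables leaves
`∑ k l, |Δ k l| (k + 1) ^ (α - 1) (l + 1) ^ (β - 1)`, where `Δ` is the mixed difference of `φ`.

For `k, l < P` the smallness of `φ` near the vertex makes this small. Otherwise `Δ k l` is
dominated by two first differences in the direction of the larger index, say `k`. The weights
`(k + 1) ^ (α - 1)` decrease, so by rearrangement a bound `V` on the `Λ`-variation gives, for each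
fixed `l`, the bound `V M p (p + 1) ^ (α - 1)` for the weighted sum of these differences over
`k ≥ p := max l P`, where `M p = ∑ j ≤ p, λ_{j+1} / (j + 1)`. Weighted by `(l + 1) ^ (β - 1)`
and summed over `l`, these bounds are controlled by the tail of `∑ l, M l (l + 1) ^ (α + β - 2)`,
which converges together with `∑ k, λ_k / k ^ (2 - α - β)`. All the estimates depend on `(x, y)`
only through the local smallness of `φ`, hence hold uniformly on compact sets of points of
continuity.
-/

namespace PartialVariation

section PowerSums

lemma rpow_le_add_one_rpow_mul {p y : ℝ} (hp : 0 ≤ p) (hp1 : p ≤ 1) (hy : 0 ≤ y) :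
    y ^ p ≤ (y + 1) ^ p * (1 - p / (y + 1)) := by
  have hy1 : 0 < y + 1 := by linarith
  have hle : (y + 1)⁻¹ ≤ 1 := inv_le_one_of_one_le₀ (by linarith)
  have bernoulli : (1 + -(y + 1)⁻¹) ^ p ≤ 1 + p * -(y + 1)⁻¹ :=
    rpow_one_add_le_one_add_mul_self (by linarith) hp hp1
  calc y ^ p = ((y + 1) * (1 + -(y + 1)⁻¹)) ^ p := by congr 1; field_simp; ring
    _ = (y + 1) ^ p * (1 + -(y + 1)⁻¹) ^ p := Real.mul_rpow hy1.le (by linarith)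
    _ ≤ (y + 1) ^ p * (1 + p * -(y + 1)⁻¹) := by gcongr
    _ = (y + 1) ^ p * (1 - p / (y + 1)) := by ring

lemma one_add_mul_self_le_rpow_one_add_of_nonpos {γ x : ℝ} (hγ : -1 ≤ γ) (hγ0 : γ ≤ 0)
    (hx : 0 ≤ x) : 1 + γ * x ≤ (1 + x) ^ γ := by
  have bernoulli : (1 + x) ^ (-γ) ≤ 1 + -γ * x :=
    rpow_one_add_le_one_add_mul_self (by linarith) (by linarith) (by linarith)
  have hpos : 0 < (1 + x) ^ (-γ) := by positivity
  have hprod : (1 + γ * x) * (1 + x) ^ (-γ) ≤ 1 := by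
    rcases le_or_gt (1 + γ * x) 0 with h | h
    · exact (mul_nonpos_of_nonpos_of_nonneg h hpos.le).trans zero_le_one
    · calc (1 + γ * x) * (1 + x) ^ (-γ) ≤ (1 + γ * x) * (1 + -γ * x) := by gcongr
        _ = 1 - (γ * x) ^ 2 := by ring
        _ ≤ 1 := sub_le_self _ (sq_nonneg _)
  rwa [← le_div_iff₀ hpos, one_div, ← Real.rpow_neg (by linarith), neg_neg] at hprod

lemma sum_range_add_one_rpow_le {r : ℝ} (hr : -1 < r) (hr0 : r ≤ 0) (N : ℕ) :
    ∑ j ∈ Finset.range N, ((j : ℝ) + 1) ^ r ≤ (N : ℝ) ^ (r + 1) / (r + 1) := by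
  have hr1 : 0 < r + 1 := by linarith
  induction N with
  | zero => simp [Real.zero_rpow hr1.ne']
  | succ N ih =>
    have hN : (0 : ℝ) < N + 1 := by positivity
    have step := rpow_le_add_one_rpow_mul hr1.le (by linarith) (Nat.cast_nonneg (α := ℝ) N)
    have hsplit : ((N : ℝ) + 1) ^ (r + 1) * (1 - (r + 1) / (N + 1)) =
        ((N : ℝ) + 1) ^ (r + 1) - (r + 1) * ((N : ℝ) + 1) ^ r := by
      rw [Real.rpow_add_one hN.ne']; field_simp
    rw [Finset.sum_range_succ]
    rw [le_div_iff₀ hr1] at ih ⊢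
    push_cast
    linarith

lemma sum_Ico_add_one_rpow_le {r : ℝ} (hr : r < -1) (k N : ℕ) :
    ∑ i ∈ Finset.Ico k N, ((i : ℝ) + 1) ^ r ≤ (1 + 1 / (-r - 1)) * ((k : ℝ) + 1) ^ (r + 1) := by
  have hr1 : 0 < -r - 1 := by linarith
  rcases le_or_gt N k with h | h
  · rw [Finset.Ico_eq_empty_of_le h, Finset.sum_empty]
    positivity
  have hhead : ((k : ℝ) + 1) ^ r ≤ ((k : ℝ) + 1) ^ (r + 1) :=
    Real.rpow_le_rpow_of_exponent_le (by simp) (by linarith)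
  have hk : (0 : ℝ) < (k + 1 : ℕ) := by positivity
  have hkN : ((k + 1 : ℕ) : ℝ) ≤ N := by exact_mod_cast h
  have htail : ∑ i ∈ Finset.Ico (k + 1) N, ((i : ℝ) + 1) ^ r ≤
      1 / (-r - 1) * ((k : ℝ) + 1) ^ (r + 1) := by
    calc ∑ i ∈ Finset.Ico (k + 1) N, ((i : ℝ) + 1) ^ r
        ≤ ∫ x in ((k + 1 : ℕ) : ℝ)..N, x ^ r := by
          have anti : AntitoneOn (fun x : ℝ => x ^ r) (Icc ((k + 1 : ℕ) : ℝ) N) :=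
            fun x hx y _ hxy =>
              Real.rpow_le_rpow_of_nonpos (hk.trans_le hx.1) hxy (by linarith)
          simpa using anti.sum_le_integral_Ico h
      _ = 1 / (-r - 1) * (((k : ℝ) + 1) ^ (r + 1) - (N : ℝ) ^ (r + 1)) := by
          rw [integral_rpow (Or.inr ⟨hr.ne, fun h0 => ?_⟩)]
          · have : r + 1 ≠ 0 := by linarith
            have : -r - 1 ≠ 0 := by linarith
            push_cast
            rw [show -r - 1 = -(r + 1) by ring]
            field_simp
            ring
          · rw [uIcc_of_le hkN] at h0
            exact (hk.trans_le h0.1).false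
      _ ≤ 1 / (-r - 1) * ((k : ℝ) + 1) ^ (r + 1) := by
          gcongr
          exact sub_le_self _ (by positivity)
  rw [Finset.sum_eq_sum_Ico_succ_bot h]
  linarith

end PowerSums

section CesaroNumbers

lemma cesaroNumber_zero (γ : ℝ) : cesaroNumber γ 0 = 1 := by simp [cesaroNumber]

lemma cesaroNumber_succ (γ : ℝ) (k : ℕ) :
    cesaroNumber γ (k + 1) = cesaroNumber γ k * (1 + γ / (k + 1)) := by
  have : (k.factorial : ℝ) ≠ 0 := by positivity
  rw [cesaroNumber, cesaroNumber, Finset.prod_Icc_succ_top (by omega), Nat.factorial_succ]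
  push_cast
  field_simp
  ring

lemma cesaroNumber_sub_one_succ (γ : ℝ) (k : ℕ) :
    cesaroNumber (γ - 1) (k + 1) = cesaroNumber γ k * (γ / (k + 1)) := by
  induction k with
  | zero => simp [cesaroNumber_succ, cesaroNumber_zero]
  | succ k ih =>
    rw [cesaroNumber_succ, ih, cesaroNumber_succ]
    push_cast
    field_simp
    ring

lemma cesaroNumber_add_cesaroNumber_sub_one_succ (γ : ℝ) (k : ℕ) :
    cesaroNumber γ k + cesaroNumber (γ - 1) (k + 1) = cesaroNumber γ (k + 1) := by
  rw [cesaroNumber_sub_one_succ, cesaroNumber_succ]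
  ring

lemma sum_range_cesaroNumber_sub_one (γ : ℝ) (n : ℕ) :
    ∑ i ∈ Finset.range (n + 1), cesaroNumber (γ - 1) i = cesaroNumber γ n := by
  induction n with
  | zero => simp [cesaroNumber_zero]
  | succ n ih =>
    rw [Finset.sum_range_succ, ih, cesaroNumber_add_cesaroNumber_sub_one_succ]

variable {γ : ℝ}

lemma one_add_div_pos (hγ : -1 < γ) (k : ℕ) : 0 < 1 + γ / ((k : ℝ) + 1) := by
  have hk : (0 : ℝ) < k + 1 := by positivity
  have : -1 < γ / ((k : ℝ) + 1) := by
    rw [lt_div_iff₀ hk]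
    linarith [Nat.cast_nonneg (α := ℝ) k]
  linarith

lemma cesaroNumber_pos (hγ : -1 < γ) (k : ℕ) : 0 < cesaroNumber γ k := by
  induction k with
  | zero => simp [cesaroNumber_zero]
  | succ k ih =>
    rw [cesaroNumber_succ]
    exact mul_pos ih (one_add_div_pos hγ k)

lemma antitone_cesaroNumber (hγ : γ ∈ Ioc (-1) 0) : Antitone (cesaroNumber γ) := by
  refine antitone_nat_of_succ_le fun k => ?_
  rw [cesaroNumber_succ]
  have : γ / ((k : ℝ) + 1) ≤ 0 := div_nonpos_of_nonpos_of_nonneg hγ.2 (by positivity)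
  exact mul_le_of_le_one_right (cesaroNumber_pos hγ.1 k).le (by linarith)

lemma cesaroNumber_le (hγ : γ ∈ Ioc (-1) 0) (k : ℕ) :
    cesaroNumber γ k ≤ ((k : ℝ) + 1) ^ γ := by
  induction k with
  | zero => simp [cesaroNumber_zero]
  | succ k ih =>
    have bernoulli := one_add_mul_self_le_rpow_one_add_of_nonpos hγ.1.le hγ.2
      (x := 1 / ((k : ℝ) + 1)) (by positivity)
    calc cesaroNumber γ (k + 1) = cesaroNumber γ k * (1 + γ * (1 / (k + 1))) := by
          rw [cesaroNumber_succ, mul_one_div]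
      _ ≤ ((k : ℝ) + 1) ^ γ * (1 + 1 / (k + 1)) ^ γ := by
          refine mul_le_mul ih bernoulli ?_ (by positivity)
          rw [mul_one_div]
          exact (one_add_div_pos hγ.1 k).le
      _ = (((k + 1 : ℕ) : ℝ) + 1) ^ γ := by
          rw [← Real.mul_rpow (by positivity) (by positivity)]
          congr 1
          push_cast
          field_simp

lemma le_cesaroNumber (hγ : γ ∈ Ioc (-1) 0) {k : ℕ} (hk : 1 ≤ k) :
    (1 + γ) * (k : ℝ) ^ γ ≤ cesaroNumber γ k := by
  have hγ1 : 0 < 1 + γ := by linarith [hγ.1]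
  induction k, hk using Nat.le_induction with
  | base => simp [cesaroNumber_succ, cesaroNumber_zero]
  | succ k hk ih =>
    have hk0 : (0 : ℝ) < k := by exact_mod_cast hk
    have step : (k : ℝ) ^ (-γ) ≤ ((k : ℝ) + 1) ^ (-γ) * (1 + γ / (k + 1)) := by
      simpa [neg_div] using
        rpow_le_add_one_rpow_mul (p := -γ) (by linarith [hγ.2]) (by linarith [hγ.1]) hk0.le
    have step' : ((k : ℝ) + 1) ^ γ ≤ (k : ℝ) ^ γ * (1 + γ / (k + 1)) := by
      rw [Real.rpow_neg hk0.le, Real.rpow_neg (by positivity), ← div_eq_inv_mul,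
        le_div_iff₀ (by positivity), inv_mul_le_iff₀ (by positivity)] at step
      exact step
    calc (1 + γ) * ((k + 1 : ℕ) : ℝ) ^ γ ≤ (1 + γ) * ((k : ℝ) ^ γ * (1 + γ / (k + 1))) := by
          push_cast
          gcongr
      _ = (1 + γ) * (k : ℝ) ^ γ * (1 + γ / (k + 1)) := by ring
      _ ≤ cesaroNumber γ k * (1 + γ / (k + 1)) :=
          mul_le_mul_of_nonneg_right ih (one_add_div_pos hγ.1 k).le
      _ = cesaroNumber γ (k + 1) := (cesaroNumber_succ γ k).symm

lemma inv_cesaroNumber_le (hγ : γ ∈ Ioc (-1) 0) {n : ℕ} (hn : 1 ≤ n) :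
    (cesaroNumber γ n)⁻¹ ≤ (1 + γ)⁻¹ * (n : ℝ) ^ (-γ) := by
  have hγ1 : 0 < 1 + γ := by linarith [hγ.1]
  have hn0 : (0 : ℝ) < n := by exact_mod_cast hn
  calc (cesaroNumber γ n)⁻¹ ≤ ((1 + γ) * (n : ℝ) ^ γ)⁻¹ :=
        inv_anti₀ (by positivity) (le_cesaroNumber hγ hn)
    _ = (1 + γ)⁻¹ * (n : ℝ) ^ (-γ) := by rw [mul_inv, Real.rpow_neg hn0.le]

lemma sum_range_cesaroNumber_le (hγ : γ ∈ Ioc (-1) 0) (n : ℕ) :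
    ∑ j ∈ Finset.range n, cesaroNumber γ j ≤ (1 + γ)⁻¹ * (n : ℝ) ^ (1 + γ) := by
  calc ∑ j ∈ Finset.range n, cesaroNumber γ j ≤ ∑ j ∈ Finset.range n, ((j : ℝ) + 1) ^ γ :=
        Finset.sum_le_sum fun j _ => cesaroNumber_le hγ j
    _ ≤ (n : ℝ) ^ (γ + 1) / (γ + 1) := sum_range_add_one_rpow_le hγ.1 hγ.2 n
    _ = (1 + γ)⁻¹ * (n : ℝ) ^ (1 + γ) := by rw [add_comm γ 1, div_eq_inv_mul]

end CesaroNumbers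

section CesaroKernel

/-- The Dirichlet kernel `1 + 2 cos s + ⋯ + 2 cos (i s)`, which represents the partial sums of a
Fourier series. -/
noncomputable def dirichletKernel (i : ℕ) (s : ℝ) : ℝ :=
  2 * ∑ k ∈ Finset.range (i + 1), Real.cos (k * s) - 1

/-- The Cesàro kernel of order `γ`, which represents the `(C; γ)` means of a Fourier series,
normalized to have mean value `1`. -/
noncomputable def cesaroKernel (γ : ℝ) (n : ℕ) (s : ℝ) : ℝ :=
  (∑ i ∈ Finset.range (n + 1), cesaroNumber (γ - 1) (n - i) * dirichletKernel i s) /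
    cesaroNumber γ n

/-- The polynomial with the Cesàro numbers of order `γ` as coefficients, a partial sum of the
expansion of `(1 - z) ^ (-γ - 1)`. -/
noncomputable def cesaroPoly (γ : ℝ) (n : ℕ) (z : ℂ) : ℂ :=
  ∑ j ∈ Finset.range (n + 1), (cesaroNumber γ j : ℂ) * z ^ j

/-- The slowly varying factor of the Cesàro kernel: up to a constant, the kernel is the real part
of `exp (-i n s)` times this quotient. -/
noncomputable def kernelQuotient (γ : ℝ) (n : ℕ) (s : ℝ) : ℂ :=
  cesaroPoly (γ - 1) n (Complex.exp (s * Complex.I)) / (1 - Complex.exp (s * Complex.I))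

lemma sum_Icc_exp_eq_dirichletKernel (i : ℕ) (s : ℝ) :
    ∑ k ∈ Finset.Icc (-(i : ℤ)) i, Complex.exp (Complex.I * k * s) = dirichletKernel i s := by
  induction i with
  | zero => norm_num [dirichletKernel]
  | succ i ih =>
    have hset : Finset.Icc (-((i + 1 : ℕ) : ℤ)) ((i + 1 : ℕ) : ℤ) =
        insert (-((i + 1 : ℕ) : ℤ)) (insert ((i + 1 : ℕ) : ℤ) (Finset.Icc (-(i : ℤ)) i)) := by
      ext x; simp only [Finset.mem_Icc, Finset.mem_insert]; omega
    have hcos := Complex.two_cos (((i + 1 : ℕ) : ℂ) * s)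
    rw [hset, Finset.sum_insert (by simp only [Finset.mem_insert, Finset.mem_Icc]; omega),
      Finset.sum_insert (by simp only [Finset.mem_Icc]; omega), ih, dirichletKernel,
      dirichletKernel, Finset.sum_range_succ _ (i + 1)]
    push_cast at hcos ⊢
    ring_nf at hcos ⊢
    rw [hcos]
    ring

lemma sum_cesaroNumber_sub_one_mul_sum (γ : ℝ) (n : ℕ) (c : ℕ → ℝ) :
    ∑ i ∈ Finset.range (n + 1), cesaroNumber (γ - 1) (n - i) * ∑ k ∈ Finset.range (i + 1), c k =
      ∑ k ∈ Finset.range (n + 1), cesaroNumber γ (n - k) * c k := by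
  induction n generalizing c with
  | zero => simp [cesaroNumber_zero]
  | succ n ih =>
    have hreflect :
        ∑ i ∈ Finset.range (n + 1), cesaroNumber (γ - 1) (n - i) = cesaroNumber γ n := by
      simpa [sum_range_cesaroNumber_sub_one] using
        Finset.sum_range_reflect (cesaroNumber (γ - 1)) (n + 1)
    rw [Finset.sum_range_succ' _ (n + 1), Finset.sum_range_succ' _ (n + 1)]
    simp only [Finset.sum_range_succ' c, mul_add, Finset.sum_add_distrib, ← Finset.sum_mul,
      Nat.add_sub_add_right, ih fun k => c (k + 1), hreflect]
    simp only [Nat.sub_zero, Finset.range_zero, Finset.sum_empty,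
      ← cesaroNumber_add_cesaroNumber_sub_one_succ γ n]
    ring

lemma one_sub_mul_cesaroPoly (γ : ℝ) (n : ℕ) (z : ℂ) :
    (1 - z) * cesaroPoly γ n z =
      cesaroPoly (γ - 1) n z - (cesaroNumber γ n : ℂ) * z ^ (n + 1) := by
  induction n with
  | zero => simp [cesaroPoly, cesaroNumber_zero]
  | succ n ih =>
    simp only [cesaroPoly] at ih ⊢
    rw [Finset.sum_range_succ, mul_add, ih, Finset.sum_range_succ _ (n + 1),
      ← cesaroNumber_add_cesaroNumber_sub_one_succ]
    push_cast
    ring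

lemma re_div_one_sub_of_norm_eq_one {z : ℂ} (hz : ‖z‖ = 1) (hz1 : z ≠ 1) :
    (z / (1 - z)).re = -1 / 2 := by
  have hsq : z.re * z.re + z.im * z.im = 1 := by
    rw [← Complex.normSq_apply, Complex.normSq_eq_norm_sq, hz, one_pow]
  have hne : Complex.normSq (1 - z) ≠ 0 := Complex.normSq_eq_zero.not.2 (sub_ne_zero.2 hz1.symm)
  rw [Complex.div_re, ← add_div, div_eq_div_iff hne two_ne_zero, Complex.normSq_apply]
  simp only [Complex.sub_re, Complex.sub_im, Complex.one_re, Complex.one_im]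
  linear_combination -hsq

variable {γ : ℝ}

lemma cesaroKernel_eq_re_cesaroPoly (hγ : -1 < γ) (n : ℕ) (s : ℝ) :
    cesaroKernel γ n s = 2 / cesaroNumber γ n *
      (Complex.exp ((-(n * s) : ℝ) * Complex.I) *
        cesaroPoly γ n (Complex.exp (s * Complex.I))).re - 1 := by
  have hA := (cesaroNumber_pos hγ n).ne'
  have hsum : ∑ i ∈ Finset.range (n + 1), cesaroNumber (γ - 1) (n - i) = cesaroNumber γ n := by
    simpa using sum_cesaroNumber_sub_one_mul_sum γ n fun k => if k = 0 then 1 else 0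
  have hre : (Complex.exp ((-(n * s) : ℝ) * Complex.I) *
      cesaroPoly γ n (Complex.exp (s * Complex.I))).re =
      ∑ k ∈ Finset.range (n + 1), cesaroNumber γ (n - k) * Real.cos (k * s) := by
    rw [cesaroPoly, Finset.mul_sum, Complex.re_sum, ← Finset.sum_range_reflect]
    refine Finset.sum_congr rfl fun k hk => ?_
    have hk : k ≤ n := Finset.mem_range_succ_iff.1 hk
    rw [Nat.add_sub_cancel, mul_left_comm, ← Complex.exp_nat_mul, ← Complex.exp_add,
      Complex.re_ofReal_mul, ← Real.cos_neg, ← Complex.exp_ofReal_mul_I_re]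
    push_cast [hk]
    ring_nf
  have hnum : ∑ i ∈ Finset.range (n + 1), cesaroNumber (γ - 1) (n - i) * dirichletKernel i s =
      2 * ∑ i ∈ Finset.range (n + 1), cesaroNumber (γ - 1) (n - i) *
        ∑ k ∈ Finset.range (i + 1), Real.cos (k * s) - cesaroNumber γ n := by
    rw [← hsum, Finset.mul_sum, ← Finset.sum_sub_distrib]
    exact Finset.sum_congr rfl fun i _ => by rw [dirichletKernel]; ring
  rw [cesaroKernel, hnum, hre, sum_cesaroNumber_sub_one_mul_sum, sub_div, div_self hA,
    mul_div_right_comm]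

lemma kernelQuotient_eq (n : ℕ) {s : ℝ} (hs : Complex.exp (s * Complex.I) ≠ 1) :
    kernelQuotient γ n s = cesaroPoly γ n (Complex.exp (s * Complex.I)) +
      (cesaroNumber γ n : ℂ) * Complex.exp (s * Complex.I) ^ (n + 1) /
        (1 - Complex.exp (s * Complex.I)) := by
  have h1 : 1 - Complex.exp (s * Complex.I) ≠ 0 := sub_ne_zero.2 hs.symm
  rw [kernelQuotient, div_eq_iff h1, add_mul, div_mul_cancel₀ _ h1]
  linear_combination -one_sub_mul_cesaroPoly γ n (Complex.exp (s * Complex.I))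

lemma cesaroKernel_eq_re_kernelQuotient (hγ : -1 < γ) (n : ℕ) {s : ℝ}
    (hs : Complex.exp (s * Complex.I) ≠ 1) :
    cesaroKernel γ n s = 2 / cesaroNumber γ n *
      (Complex.exp ((-(n * s) : ℝ) * Complex.I) * kernelQuotient γ n s).re := by
  have hA := (cesaroNumber_pos hγ n).ne'
  have hexp : Complex.exp ((-(n * s) : ℝ) * Complex.I) * Complex.exp (s * Complex.I) ^ (n + 1) =
      Complex.exp (s * Complex.I) := by
    rw [← Complex.exp_nat_mul, ← Complex.exp_add]
    push_cast
    ring_nf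
  have hre := re_div_one_sub_of_norm_eq_one (Complex.norm_exp_ofReal_mul_I s) hs
  rw [cesaroKernel_eq_re_cesaroPoly hγ, kernelQuotient_eq n hs, mul_add, Complex.add_re,
    mul_div_assoc, mul_left_comm _ (cesaroNumber γ n : ℂ), ← mul_div_assoc, hexp,
    Complex.re_ofReal_mul, hre]
  field_simp
  ring

end CesaroKernel

section ExpBounds

lemma two_div_pi_mul_le_norm_one_sub_exp {s : ℝ} (hs : 0 ≤ s) (hs' : s ≤ Real.pi) :
    2 / Real.pi * s ≤ ‖1 - Complex.exp (s * Complex.I)‖ := by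
  rw [norm_sub_rev, mul_comm (s : ℂ), Complex.norm_exp_I_mul_ofReal_sub_one, Real.norm_eq_abs]
  have jordan := Real.mul_le_sin (x := s / 2) (by linarith) (by linarith)
  refine le_trans ?_ (le_abs_self _)
  linarith

lemma exp_mul_I_ne_one {s : ℝ} (hs : 0 < s) (hs' : s ≤ Real.pi) :
    Complex.exp (s * Complex.I) ≠ 1 := by
  have hpos : 0 < ‖1 - Complex.exp (s * Complex.I)‖ :=
    lt_of_lt_of_le (by positivity) (two_div_pi_mul_le_norm_one_sub_exp hs.le hs')
  exact (sub_ne_zero.1 (norm_pos_iff.1 hpos)).symm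

lemma inv_norm_one_sub_exp_le {s : ℝ} (hs : 0 < s) (hs' : s ≤ Real.pi) :
    ‖1 - Complex.exp (s * Complex.I)‖⁻¹ ≤ Real.pi / 2 * s⁻¹ := by
  have := inv_anti₀ (by positivity) (two_div_pi_mul_le_norm_one_sub_exp hs.le hs')
  rwa [mul_inv, inv_div] at this

lemma norm_one_sub_mul_sum_Ico_le {B : ℕ → ℝ} (hB : Antitone B) (hB0 : ∀ j, 0 ≤ B j) {z : ℂ}
    (hz : ‖z‖ = 1) {p N : ℕ} (h : p ≤ N) :
    ‖(1 - z) * ∑ j ∈ Finset.Ico p N, (B j : ℂ) * z ^ j‖ ≤ 2 * B p := by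
  have norm_mul_pow (b : ℝ) (j : ℕ) (hb : 0 ≤ b) : ‖(b : ℂ) * z ^ j‖ = b := by
    rw [norm_mul, norm_pow, hz, one_pow, mul_one, Complex.norm_real, Real.norm_of_nonneg hb]
  have abel : ‖(1 - z) * ∑ j ∈ Finset.Ico p N, (B j : ℂ) * z ^ j + B N * z ^ N‖ ≤
      2 * B p - B N := by
    induction N, h using Nat.le_induction with
    | base =>
      rw [Finset.Ico_self, Finset.sum_empty, mul_zero, zero_add, norm_mul_pow _ _ (hB0 p)]
      linarith
    | succ N hN ih =>
      have step : (1 - z) * ∑ j ∈ Finset.Ico p (N + 1), (B j : ℂ) * z ^ j +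
          B (N + 1) * z ^ (N + 1) =
          ((1 - z) * ∑ j ∈ Finset.Ico p N, (B j : ℂ) * z ^ j + B N * z ^ N) -
            ((B N - B (N + 1) : ℝ) : ℂ) * z ^ (N + 1) := by
        rw [Finset.sum_Ico_succ_top hN]
        push_cast
        ring
      rw [step]
      refine (norm_sub_le _ _).trans ?_
      rw [norm_mul_pow _ _ (sub_nonneg.2 (hB N.le_succ))]
      linarith
  have htri := norm_sub_le ((1 - z) * ∑ j ∈ Finset.Ico p N, (B j : ℂ) * z ^ j + B N * z ^ N)
    ((B N : ℂ) * z ^ N)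
  rw [add_sub_cancel_right, norm_mul_pow _ _ (hB0 N)] at htri
  linarith

end ExpBounds

section KernelBounds

variable {γ : ℝ}

lemma norm_sum_cesaroNumber_mul_pow_le (hγ : γ ∈ Ioc (-1) 0) {z : ℂ} (hz : ‖z‖ = 1) (N : ℕ) :
    ‖∑ j ∈ Finset.range N, (cesaroNumber γ j : ℂ) * z ^ j‖ ≤ (1 + γ)⁻¹ * (N : ℝ) ^ (1 + γ) := by
  refine (norm_sum_le _ _).trans (le_trans (Finset.sum_le_sum fun j _ => ?_)
    (sum_range_cesaroNumber_le hγ N))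
  rw [norm_mul, norm_pow, hz, one_pow, mul_one, Complex.norm_real,
    Real.norm_of_nonneg (cesaroNumber_pos hγ.1 j).le]

lemma norm_sum_Ico_cesaroNumber_mul_exp_pow_le (hγ : γ ∈ Ioc (-1) 0) {s : ℝ} (hs : 0 < s)
    (hs' : s ≤ Real.pi) {p N : ℕ} (hp : 1 / s ≤ p) (hpN : p ≤ N) :
    ‖∑ j ∈ Finset.Ico p N, (cesaroNumber γ j : ℂ) * Complex.exp (s * Complex.I) ^ j‖ ≤
      Real.pi * s ^ (-γ - 1) := by
  have hA : cesaroNumber γ p ≤ s ^ (-γ) := by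
    calc cesaroNumber γ p ≤ ((p : ℝ) + 1) ^ γ := cesaroNumber_le hγ p
      _ ≤ (1 / s) ^ γ := Real.rpow_le_rpow_of_nonpos (by positivity) (by linarith) hγ.2
      _ = s ^ (-γ) := by rw [one_div, Real.inv_rpow hs.le, Real.rpow_neg hs.le]
  have habel := norm_one_sub_mul_sum_Ico_le (antitone_cesaroNumber hγ)
    (fun j => (cesaroNumber_pos hγ.1 j).le) (Complex.norm_exp_ofReal_mul_I s) hpN
  have hpos : 0 < ‖1 - Complex.exp (s * Complex.I)‖ :=
    norm_pos_iff.2 (sub_ne_zero.2 (exp_mul_I_ne_one hs hs').symm)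
  rw [norm_mul, mul_comm, ← le_div_iff₀ hpos, div_eq_mul_inv] at habel
  calc _ ≤ 2 * cesaroNumber γ p * ‖1 - Complex.exp (s * Complex.I)‖⁻¹ := habel
    _ ≤ 2 * s ^ (-γ) * (Real.pi / 2 * s⁻¹) := by
        gcongr
        exact inv_norm_one_sub_exp_le hs hs'
    _ = Real.pi * s ^ (-γ - 1) := by rw [Real.rpow_sub_one hs.ne']; ring

/- Below the index `1 / s` the terms are summed absolutely, beyond it by Abel summation. -/
lemma exists_norm_cesaroPoly_exp_le (hγ : γ ∈ Ioc (-1) 0) :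
    ∃ C > 0, ∀ (N : ℕ) (s : ℝ), 0 < s → s ≤ Real.pi →
      ‖cesaroPoly γ N (Complex.exp (s * Complex.I))‖ ≤ C * s ^ (-γ - 1) := by
  have hγ1 : 0 < 1 + γ := by linarith [hγ.1]
  refine ⟨(1 + γ)⁻¹ * (1 + Real.pi) ^ (1 + γ) + Real.pi, by positivity, fun N s hs hs' => ?_⟩
  set z := Complex.exp (s * Complex.I)
  set p := ⌈1 / s⌉₊
  have hp : 1 / s ≤ p := Nat.le_ceil _
  have hp' : (p : ℝ) ≤ (1 + Real.pi) * s⁻¹ := by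
    have h1 : (p : ℝ) < 1 / s + 1 := Nat.ceil_lt_add_one (by positivity)
    have h2 : 1 ≤ Real.pi * s⁻¹ := by rwa [← div_eq_mul_inv, one_le_div hs]
    rw [one_div] at h1
    linarith
  have head (M : ℕ) (hM : M ≤ p) : ‖∑ j ∈ Finset.range M, (cesaroNumber γ j : ℂ) * z ^ j‖ ≤
      (1 + γ)⁻¹ * (1 + Real.pi) ^ (1 + γ) * s ^ (-γ - 1) := by
    calc ‖∑ j ∈ Finset.range M, (cesaroNumber γ j : ℂ) * z ^ j‖
        ≤ (1 + γ)⁻¹ * (M : ℝ) ^ (1 + γ) :=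
          norm_sum_cesaroNumber_mul_pow_le hγ (Complex.norm_exp_ofReal_mul_I s) M
      _ ≤ (1 + γ)⁻¹ * ((1 + Real.pi) * s⁻¹) ^ (1 + γ) := by
          gcongr
          exact le_trans (by exact_mod_cast hM) hp'
      _ = (1 + γ)⁻¹ * (1 + Real.pi) ^ (1 + γ) * s ^ (-γ - 1) := by
          rw [Real.mul_rpow (by positivity) (by positivity), Real.inv_rpow hs.le,
            ← Real.rpow_neg hs.le, mul_assoc]
          ring_nf
  rw [cesaroPoly, add_mul]
  rcases le_total p (N + 1) with h | h
  · rw [← Finset.sum_range_add_sum_Ico _ h]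
    exact (norm_add_le _ _).trans (add_le_add (head p le_rfl)
      (norm_sum_Ico_cesaroNumber_mul_exp_pow_le hγ hs hs' hp h))
  · exact (head (N + 1) h).trans (le_add_of_nonneg_right (by positivity))

lemma hasDerivAt_cesaroPoly_exp (γ : ℝ) (N : ℕ) (s : ℝ) :
    HasDerivAt (fun x : ℝ => cesaroPoly (γ - 1) (N + 1) (Complex.exp (x * Complex.I)))
      (γ * (Complex.exp (s * Complex.I) * Complex.I) *
        cesaroPoly γ N (Complex.exp (s * Complex.I))) s := by
  have hexp : HasDerivAt (fun x : ℝ => Complex.exp (x * Complex.I))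
      (Complex.exp (s * Complex.I) * Complex.I) s := by
    simpa using ((hasDerivAt_id s).ofReal_comp.mul_const Complex.I).cexp
  have hterm (j : ℕ) : HasDerivAt (fun x : ℝ => (cesaroNumber (γ - 1) (j + 1) : ℂ) *
      Complex.exp (x * Complex.I) ^ (j + 1)) (γ * (Complex.exp (s * Complex.I) * Complex.I) *
        (cesaroNumber γ j * Complex.exp (s * Complex.I) ^ j)) s := by
    refine ((hexp.pow (j + 1)).const_mul (cesaroNumber (γ - 1) (j + 1) : ℂ)).congr_deriv ?_
    have hj : (j : ℂ) + 1 ≠ 0 := Nat.cast_add_one_ne_zero j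
    rw [cesaroNumber_sub_one_succ]
    push_cast
    field_simp
  simp only [cesaroPoly, Finset.sum_range_succ' _ (N + 1), pow_zero, mul_one, Finset.mul_sum]
  exact (HasDerivAt.fun_sum fun j _ => hterm j).add_const _

lemma hasDerivAt_kernelQuotient (γ : ℝ) (N : ℕ) {s : ℝ} (hs : Complex.exp (s * Complex.I) ≠ 1) :
    HasDerivAt (kernelQuotient γ (N + 1))
      (Complex.exp (s * Complex.I) * Complex.I / (1 - Complex.exp (s * Complex.I)) *
        (γ * cesaroPoly γ N (Complex.exp (s * Complex.I)) + kernelQuotient γ (N + 1) s)) s := by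
  have h1 : 1 - Complex.exp (s * Complex.I) ≠ 0 := sub_ne_zero.2 hs.symm
  have hden : HasDerivAt (fun x : ℝ => 1 - Complex.exp (x * Complex.I))
      (-(Complex.exp (s * Complex.I) * Complex.I)) s := by
    simpa using (((hasDerivAt_id s).ofReal_comp.mul_const Complex.I).cexp).const_sub 1
  refine ((hasDerivAt_cesaroPoly_exp γ N s).div hden h1).congr_deriv ?_
  rw [kernelQuotient]
  field_simp
  ring

lemma cesaroNumber_le_rpow_of_one_div_le (hγ : γ ∈ Ioc (-1) 0) {n : ℕ} (hn : 1 ≤ n) {s : ℝ}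
    (hs : 1 / (n : ℝ) ≤ s) : cesaroNumber γ n ≤ s ^ (-γ) := by
  have hn0 : (0 : ℝ) < n := by exact_mod_cast hn
  calc cesaroNumber γ n ≤ ((n : ℝ) + 1) ^ γ := cesaroNumber_le hγ n
    _ ≤ (n : ℝ) ^ γ := Real.rpow_le_rpow_of_nonpos hn0 (by linarith) hγ.2
    _ = (1 / (n : ℝ)) ^ (-γ) := by
        rw [one_div, Real.inv_rpow hn0.le, Real.rpow_neg hn0.le, inv_inv]
    _ ≤ s ^ (-γ) := Real.rpow_le_rpow (by positivity) hs (by linarith [hγ.2])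

lemma exists_norm_kernelQuotient_le (hγ : γ ∈ Ioc (-1) 0) :
    ∃ C > 0, ∀ n : ℕ, 1 ≤ n → ∀ s : ℝ, 1 / (n : ℝ) ≤ s → s ≤ Real.pi →
      ‖kernelQuotient γ n s‖ ≤ C * s ^ (-γ - 1) := by
  obtain ⟨C, hC, hP⟩ := exists_norm_cesaroPoly_exp_le hγ
  refine ⟨C + Real.pi / 2, by positivity, fun n hn s hs hs' => ?_⟩
  have hs0 : 0 < s := lt_of_lt_of_le (by positivity) hs
  calc ‖kernelQuotient γ n s‖
      ≤ ‖cesaroPoly γ n (Complex.exp (s * Complex.I))‖ +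
          cesaroNumber γ n * ‖1 - Complex.exp (s * Complex.I)‖⁻¹ := by
        rw [kernelQuotient_eq n (exp_mul_I_ne_one hs0 hs')]
        refine (norm_add_le _ _).trans_eq ?_
        rw [norm_div, norm_mul, norm_pow, Complex.norm_exp_ofReal_mul_I, one_pow, mul_one,
          Complex.norm_real, Real.norm_of_nonneg (cesaroNumber_pos hγ.1 n).le, div_eq_mul_inv]
    _ ≤ C * s ^ (-γ - 1) + s ^ (-γ) * (Real.pi / 2 * s⁻¹) :=
        add_le_add (hP n s hs0 hs') (mul_le_mul (cesaroNumber_le_rpow_of_one_div_le hγ hn hs)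
          (inv_norm_one_sub_exp_le hs0 hs') (by positivity) (by positivity))
    _ = (C + Real.pi / 2) * s ^ (-γ - 1) := by rw [Real.rpow_sub_one hs0.ne']; ring

lemma exists_norm_kernelQuotient_sub_le (hγ : γ ∈ Ioc (-1) 0) :
    ∃ C > 0, ∀ n : ℕ, 1 ≤ n → ∀ s t : ℝ, 1 / (n : ℝ) ≤ s → s ≤ t → t ≤ Real.pi →
      ‖kernelQuotient γ n s - kernelQuotient γ n t‖ ≤ C * s ^ (-γ - 2) * (t - s) := by
  obtain ⟨C, hC, hP⟩ := exists_norm_cesaroPoly_exp_le hγ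
  obtain ⟨C', hC', hQ⟩ := exists_norm_kernelQuotient_le hγ
  refine ⟨Real.pi / 2 * (C + C'), by positivity, fun n hn s t hs hst ht => ?_⟩
  obtain ⟨N, rfl⟩ := Nat.exists_eq_add_of_le' hn
  have hs0 : 0 < s := lt_of_lt_of_le (by positivity) hs
  have hderiv (x : ℝ) (hx : x ∈ Icc s t) :=
    hasDerivAt_kernelQuotient γ N (exp_mul_I_ne_one (hs0.trans_le hx.1) (hx.2.trans ht))
  rw [norm_sub_rev, ← Real.norm_of_nonneg (sub_nonneg.2 hst)]
  refine (convex_Icc s t).norm_image_sub_le_of_norm_hasDerivWithin_le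
    (fun x hx => (hderiv x hx).hasDerivWithinAt) (fun x hx => ?_) ⟨le_rfl, hst⟩ ⟨hst, le_rfl⟩
  have hx0 : 0 < x := hs0.trans_le hx.1
  have hxpi : x ≤ Real.pi := hx.2.trans ht
  have hγP : ‖(γ : ℂ) * cesaroPoly γ N (Complex.exp (x * Complex.I))‖ ≤ C * x ^ (-γ - 1) := by
    rw [norm_mul, Complex.norm_real]
    exact (mul_le_of_le_one_left (norm_nonneg _)
      (abs_le.2 ⟨hγ.1.le, hγ.2.trans zero_le_one⟩)).trans (hP N x hx0 hxpi)
  rw [norm_mul, norm_div, norm_mul, Complex.norm_exp_ofReal_mul_I, Complex.norm_I, one_mul,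
    one_div]
  calc _ ≤ Real.pi / 2 * x⁻¹ * (C * x ^ (-γ - 1) + C' * x ^ (-γ - 1)) :=
        mul_le_mul (inv_norm_one_sub_exp_le hx0 hxpi) ((norm_add_le _ _).trans
          (add_le_add hγP (hQ _ hn x (hs.trans hx.1) hxpi))) (norm_nonneg _) (by positivity)
    _ = Real.pi / 2 * (C + C') * x ^ (-γ - 2) := by
        rw [show -γ - 2 = -γ - 1 - 1 by ring, Real.rpow_sub_one hx0.ne' (-γ - 1)]
        ring
    _ ≤ Real.pi / 2 * (C + C') * s ^ (-γ - 2) :=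
        mul_le_mul_of_nonneg_left
          (Real.rpow_le_rpow_of_nonpos hs0 hx.1 (by linarith [hγ.1])) (by positivity)

lemma le_mul_one_add_rpow {q t A X : ℝ} (hq : q ≤ 0) (ht : 0 ≤ t) (hA : 0 ≤ A) (hX : X ≤ A)
    (hX' : 1 ≤ t → X ≤ A * t ^ q) : X ≤ A * 2 ^ (-q) * (1 + t) ^ q := by
  have hmean : A * 2 ^ (-q) * (1 + t) ^ q = A * ((1 + t) / 2) ^ q := by
    rw [Real.div_rpow (by linarith) zero_le_two, Real.rpow_neg zero_le_two]
    ring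
  rw [hmean]
  rcases le_total 1 t with h | h
  · exact (hX' h).trans (mul_le_mul_of_nonneg_left
      (Real.rpow_le_rpow_of_nonpos (by linarith) (by linarith) hq) hA)
  · exact hX.trans (le_mul_of_one_le_right hA
      (Real.one_le_rpow_of_pos_of_le_one_of_nonpos (by linarith) (by linarith) hq))

lemma abs_cesaroKernel_le_norm_cesaroPoly (hγ : -1 < γ) (n : ℕ) (s : ℝ) :
    |cesaroKernel γ n s| ≤
      2 * (cesaroNumber γ n)⁻¹ * ‖cesaroPoly γ n (Complex.exp (s * Complex.I))‖ + 1 := by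
  have hA := cesaroNumber_pos hγ n
  rw [cesaroKernel_eq_re_cesaroPoly hγ]
  refine (abs_sub _ _).trans ?_
  rw [abs_one, abs_mul, abs_of_pos (by positivity), div_eq_mul_inv]
  gcongr
  refine (Complex.abs_re_le_norm _).trans_eq ?_
  rw [norm_mul, Complex.norm_exp_ofReal_mul_I, one_mul]

lemma exists_abs_cesaroKernel_le_mul (hγ : γ ∈ Ioc (-1) 0) :
    ∃ C > 0, ∀ n : ℕ, 1 ≤ n → ∀ s, |cesaroKernel γ n s| ≤ C * n := by
  have hγ1 : 0 < 1 + γ := by linarith [hγ.1]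
  refine ⟨4 * (1 + γ)⁻¹ ^ 2 + 1, by positivity, fun n hn s => ?_⟩
  have hn1 : (1 : ℝ) ≤ n := by exact_mod_cast hn
  have hn0 : (0 : ℝ) < n := by linarith
  have hpow : ((n + 1 : ℕ) : ℝ) ^ (1 + γ) ≤ 2 * (n : ℝ) ^ (1 + γ) := by
    calc ((n + 1 : ℕ) : ℝ) ^ (1 + γ) ≤ (2 * (n : ℝ)) ^ (1 + γ) := by
          gcongr
          push_cast
          linarith
      _ = 2 ^ (1 + γ) * (n : ℝ) ^ (1 + γ) := Real.mul_rpow zero_le_two hn0.le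
      _ ≤ 2 * (n : ℝ) ^ (1 + γ) := by
          gcongr
          exact Real.rpow_le_self_of_one_le one_le_two (by linarith [hγ.2])
  calc |cesaroKernel γ n s|
      ≤ 2 * (cesaroNumber γ n)⁻¹ * ‖cesaroPoly γ n (Complex.exp (s * Complex.I))‖ + 1 :=
        abs_cesaroKernel_le_norm_cesaroPoly hγ.1 n s
    _ ≤ 2 * ((1 + γ)⁻¹ * (n : ℝ) ^ (-γ)) * ((1 + γ)⁻¹ * (2 * (n : ℝ) ^ (1 + γ))) + n := by
        gcongr
        · exact inv_cesaroNumber_le hγ hn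
        · exact (norm_sum_cesaroNumber_mul_pow_le hγ (Complex.norm_exp_ofReal_mul_I s) _).trans
            (mul_le_mul_of_nonneg_left hpow (by positivity))
    _ = (4 * (1 + γ)⁻¹ ^ 2 + 1) * n := by
        have : (n : ℝ) ^ (-γ) * (n : ℝ) ^ (1 + γ) = n := by
          rw [← Real.rpow_add hn0]
          simp
        linear_combination 4 * (1 + γ)⁻¹ ^ 2 * this

lemma exists_abs_cesaroKernel_le (hγ : γ ∈ Ioc (-1) 0) :
    ∃ C > 0, ∀ n : ℕ, 1 ≤ n → ∀ s, 0 ≤ s → s ≤ Real.pi →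
      |cesaroKernel γ n s| ≤ C * n * (1 + n * s) ^ (-γ - 1) := by
  have hγ1 : 0 < 1 + γ := by linarith [hγ.1]
  obtain ⟨C, hC, hK⟩ := exists_abs_cesaroKernel_le_mul hγ
  obtain ⟨C', hC', hP⟩ := exists_norm_cesaroPoly_exp_le hγ
  set B := C + 2 * (1 + γ)⁻¹ * C' + Real.pi with hB
  have : 0 < B := by positivity
  refine ⟨B * 2 ^ (-(-γ - 1)), by positivity, fun n hn s hs hs' => ?_⟩
  have hn0 : (0 : ℝ) < n := by exact_mod_cast hn
  have hCB : C ≤ B := by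
    have : 0 ≤ 2 * (1 + γ)⁻¹ * C' + Real.pi := by positivity
    linarith [hB]
  have far (h : 1 ≤ n * s) : |cesaroKernel γ n s| ≤ B * n * (n * s) ^ (-γ - 1) := by
    have hs0 : 0 < s := pos_of_mul_pos_right (by linarith) hn0.le
    have hone : 1 ≤ Real.pi * n * (n * s) ^ (-γ - 1) := by
      calc 1 ≤ Real.pi * s⁻¹ := by rwa [← div_eq_mul_inv, one_le_div hs0]
        _ = Real.pi * n * (n * s) ^ (-1 : ℝ) := by rw [Real.rpow_neg_one]; field_simp
        _ ≤ Real.pi * n * (n * s) ^ (-γ - 1) := by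
            gcongr
            linarith [hγ.2]
    calc |cesaroKernel γ n s|
        ≤ 2 * (cesaroNumber γ n)⁻¹ * ‖cesaroPoly γ n (Complex.exp (s * Complex.I))‖ + 1 :=
          abs_cesaroKernel_le_norm_cesaroPoly hγ.1 n s
      _ ≤ 2 * ((1 + γ)⁻¹ * (n : ℝ) ^ (-γ)) * (C' * s ^ (-γ - 1)) +
          Real.pi * n * (n * s) ^ (-γ - 1) := by
          gcongr
          · exact inv_cesaroNumber_le hγ hn
          · exact hP n s hs0 hs'
      _ = (2 * (1 + γ)⁻¹ * C' + Real.pi) * n * (n * s) ^ (-γ - 1) := by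
          rw [Real.mul_rpow hn0.le hs, Real.rpow_sub_one hn0.ne']
          field_simp
      _ ≤ B * n * (n * s) ^ (-γ - 1) := by gcongr; linarith
  calc |cesaroKernel γ n s| ≤ B * n * 2 ^ (-(-γ - 1)) * (1 + n * s) ^ (-γ - 1) :=
        le_mul_one_add_rpow (by linarith) (by positivity) (by positivity)
          ((hK n hn s).trans (by gcongr)) far
    _ = B * 2 ^ (-(-γ - 1)) * n * (1 + n * s) ^ (-γ - 1) := by ring

/- Shifting the argument by `π / n` changes the sign of the oscillating factor `exp (-i n s)`. -/
lemma abs_cesaroKernel_add_le_norm_kernelQuotient_sub (hγ : -1 < γ) {n : ℕ} (hn : 1 ≤ n) {s : ℝ}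
    (hs : 0 < s) (hs' : s + Real.pi / n ≤ Real.pi) :
    |cesaroKernel γ n s + cesaroKernel γ n (s + Real.pi / n)| ≤
      2 * (cesaroNumber γ n)⁻¹ *
        ‖kernelQuotient γ n s - kernelQuotient γ n (s + Real.pi / n)‖ := by
  have hA := cesaroNumber_pos hγ n
  have hstep : 0 ≤ Real.pi / n := by positivity
  have hn0 : (n : ℝ) ≠ 0 := by positivity
  have hexp : Complex.exp ((-(n * (s + Real.pi / n)) : ℝ) * Complex.I) =
      -Complex.exp ((-(n * s) : ℝ) * Complex.I) := by
    rw [← Complex.exp_sub_pi_mul_I, ← sub_mul, mul_add, mul_div_cancel₀ _ hn0]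
    congr 1
    push_cast
    ring
  rw [cesaroKernel_eq_re_kernelQuotient hγ n (exp_mul_I_ne_one hs (by linarith)),
    cesaroKernel_eq_re_kernelQuotient hγ n (exp_mul_I_ne_one (by linarith) hs'), hexp, neg_mul,
    Complex.neg_re, mul_neg, ← sub_eq_add_neg, ← mul_sub, ← Complex.sub_re, ← mul_sub, abs_mul,
    abs_of_pos (by positivity), div_eq_mul_inv]
  gcongr
  refine (Complex.abs_re_le_norm _).trans_eq ?_
  rw [norm_mul, Complex.norm_exp_ofReal_mul_I, one_mul]

lemma exists_abs_cesaroKernel_add_le (hγ : γ ∈ Ioc (-1) 0) :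
    ∃ C > 0, ∀ n : ℕ, 1 ≤ n → ∀ s, 0 ≤ s → s + Real.pi / n ≤ Real.pi →
      |cesaroKernel γ n s + cesaroKernel γ n (s + Real.pi / n)| ≤
        C * n * (1 + n * s) ^ (-γ - 2) := by
  have hγ1 : 0 < 1 + γ := by linarith [hγ.1]
  obtain ⟨C, hC, hK⟩ := exists_abs_cesaroKernel_le_mul hγ
  obtain ⟨C', hC', hQ⟩ := exists_norm_kernelQuotient_sub_le hγ
  set B := 2 * C + 2 * (1 + γ)⁻¹ * C' * Real.pi with hB
  have : 0 < B := by positivity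
  refine ⟨B * 2 ^ (-(-γ - 2)), by positivity, fun n hn s hs hs' => ?_⟩
  have hn0 : (0 : ℝ) < n := by exact_mod_cast hn
  have near : |cesaroKernel γ n s + cesaroKernel γ n (s + Real.pi / n)| ≤ B * n := by
    have : 0 ≤ 2 * (1 + γ)⁻¹ * C' * Real.pi * n := by positivity
    linarith [abs_add_le (cesaroKernel γ n s) (cesaroKernel γ n (s + Real.pi / n)), hK n hn s,
      hK n hn (s + Real.pi / n)]
  have far (h : 1 ≤ n * s) : |cesaroKernel γ n s + cesaroKernel γ n (s + Real.pi / n)| ≤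
      B * n * (n * s) ^ (-γ - 2) := by
    have hs0 : 0 < s := pos_of_mul_pos_right (by linarith) hn0.le
    have hlip := hQ n hn s (s + Real.pi / n) (by rwa [div_le_iff₀' hn0])
      (le_add_of_nonneg_right (by positivity)) hs'
    rw [add_sub_cancel_left] at hlip
    calc |cesaroKernel γ n s + cesaroKernel γ n (s + Real.pi / n)|
        ≤ 2 * (cesaroNumber γ n)⁻¹ *
            ‖kernelQuotient γ n s - kernelQuotient γ n (s + Real.pi / n)‖ :=
          abs_cesaroKernel_add_le_norm_kernelQuotient_sub hγ.1 hn hs0 hs'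
      _ ≤ 2 * ((1 + γ)⁻¹ * (n : ℝ) ^ (-γ)) * (C' * s ^ (-γ - 2) * (Real.pi / n)) := by
          gcongr
          exact inv_cesaroNumber_le hγ hn
      _ = 2 * (1 + γ)⁻¹ * C' * Real.pi * n * (n * s) ^ (-γ - 2) := by
          rw [Real.mul_rpow hn0.le hs, Real.rpow_sub hn0 (-γ) 2, Real.rpow_two]
          field_simp
      _ ≤ B * n * (n * s) ^ (-γ - 2) := by gcongr; linarith [hB]
  calc |cesaroKernel γ n s + cesaroKernel γ n (s + Real.pi / n)|
      ≤ B * n * 2 ^ (-(-γ - 2)) * (1 + n * s) ^ (-γ - 2) :=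
        le_mul_one_add_rpow (by linarith) (by positivity) (by positivity) near far
    _ = B * 2 ^ (-(-γ - 2)) * n * (1 + n * s) ^ (-γ - 2) := by ring

end KernelBounds

section KernelTails

lemma abs_sum_Ico_le_of_alternating {K : ℕ → ℝ} {n : ℕ} {C r : ℝ} (hC : 0 ≤ C) (hr : r < 0)
    (hK : ∀ k < n, |K k| ≤ C * ((k : ℝ) + 1) ^ r)
    (hK' : ∀ k, k + 1 < n → |K k + K (k + 1)| ≤ C * ((k : ℝ) + 1) ^ (r - 1)) (k : ℕ) :
    |∑ i ∈ Finset.Ico k n, K i| ≤ C * (2 + 1 / -r) * ((k : ℝ) + 1) ^ r := by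
  rcases le_or_gt n k with h | h
  · rw [Finset.Ico_eq_empty_of_le h, Finset.sum_empty, abs_zero]
    have : 0 < -r := by linarith
    positivity
  obtain ⟨m, rfl⟩ : ∃ m, n = m + 1 := ⟨n - 1, by omega⟩
  have hkm : k ≤ m := Nat.lt_succ_iff.1 h
  have htwo : 2 * ∑ i ∈ Finset.Ico k (m + 1), K i =
      K k + K m + ∑ i ∈ Finset.Ico k m, (K i + K (i + 1)) := by
    rw [Finset.sum_add_distrib, Finset.sum_Ico_add' K k m 1]
    linear_combination Finset.sum_Ico_succ_top hkm K + Finset.sum_eq_sum_Ico_succ_bot h K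
  have hm : |K m| ≤ C * ((k : ℝ) + 1) ^ r := by
    refine (hK m m.lt_succ_self).trans (mul_le_mul_of_nonneg_left
      (Real.rpow_le_rpow_of_nonpos (by positivity) ?_ hr.le) hC)
    gcongr
  have hpairs : |∑ i ∈ Finset.Ico k m, (K i + K (i + 1))| ≤
      C * ((1 + 1 / -r) * ((k : ℝ) + 1) ^ r) := by
    calc |∑ i ∈ Finset.Ico k m, (K i + K (i + 1))|
        ≤ ∑ i ∈ Finset.Ico k m, |K i + K (i + 1)| := Finset.abs_sum_le_sum_abs _ _
      _ ≤ ∑ i ∈ Finset.Ico k m, C * ((i : ℝ) + 1) ^ (r - 1) :=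
          Finset.sum_le_sum fun i hi => hK' i (Nat.succ_lt_succ (Finset.mem_Ico.1 hi).2)
      _ ≤ C * ((1 + 1 / -r) * ((k : ℝ) + 1) ^ r) := by
          rw [← Finset.mul_sum]
          refine mul_le_mul_of_nonneg_left ?_ hC
          simpa using sum_Ico_add_one_rpow_le (r := r - 1) (by linarith) k m
  have htri : 2 * |∑ i ∈ Finset.Ico k (m + 1), K i| ≤
      |K k| + |K m| + |∑ i ∈ Finset.Ico k m, (K i + K (i + 1))| := by
    calc 2 * |∑ i ∈ Finset.Ico k (m + 1), K i| = |2 * ∑ i ∈ Finset.Ico k (m + 1), K i| := by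
          rw [abs_mul, abs_two]
      _ ≤ |K k| + |K m| + |∑ i ∈ Finset.Ico k m, (K i + K (i + 1))| := by
          rw [htwo]
          exact abs_add_three _ _ _
  have hhalf : 0 ≤ C * ((1 / -r) * ((k : ℝ) + 1) ^ r) := by
    have : 0 < -r := by linarith
    positivity
  linarith [hK k h, abs_nonneg (K k)]

lemma exists_abs_sum_cesaroKernel_le {γ : ℝ} (hγ : γ ∈ Ioc (-1) 0) :
    ∃ C > 0, ∀ n : ℕ, 1 ≤ n → ∀ u ∈ Icc 0 (Real.pi / n), ∀ k,
      |∑ i ∈ Finset.Ico k n, cesaroKernel γ n (u + i * (Real.pi / n))| ≤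
        C * n * ((k : ℝ) + 1) ^ (-γ - 1) := by
  have hγ1 : 0 < 1 + γ := by linarith [hγ.1]
  obtain ⟨C, hC, hK⟩ := exists_abs_cesaroKernel_le hγ
  obtain ⟨C', hC', hK'⟩ := exists_abs_cesaroKernel_add_le hγ
  have hr : 0 < -(-γ - 1) := by linarith
  refine ⟨(C + C') * (2 + 1 / -(-γ - 1)), by positivity, fun n hn u hu k => ?_⟩
  have hn0 : (0 : ℝ) < n := by exact_mod_cast hn
  set δ := Real.pi / n with hδ
  have hδ0 : 0 < δ := by positivity
  have hnδ : n * δ = Real.pi := by rw [hδ]; field_simp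
  have hgrid (i : ℕ) : (i : ℝ) + 1 ≤ 1 + n * (u + i * δ) := by
    have h1 : (i : ℝ) ≤ i * Real.pi :=
      le_mul_of_one_le_right i.cast_nonneg (by linarith [Real.pi_gt_three])
    have h2 : 0 ≤ n * u := mul_nonneg hn0.le hu.1
    nlinarith [h1, h2, hnδ]
  have hle (i : ℕ) (hi : i < n) : u + i * δ ≤ Real.pi := by
    have h1 : (i : ℝ) + 1 ≤ n := by exact_mod_cast hi
    nlinarith [hu.2, hnδ]
  have hrpow (i : ℕ) {q D : ℝ} (hq : q ≤ 0) (hD : D ≤ C + C') :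
      D * n * (1 + n * (u + i * δ)) ^ q ≤ (C + C') * n * ((i : ℝ) + 1) ^ q := by
    have : 0 ≤ 1 + n * (u + i * δ) := le_trans (by positivity) (hgrid i)
    gcongr ?_ * n * ?_
    exact Real.rpow_le_rpow_of_nonpos (by positivity) (hgrid i) hq
  have hu0 (i : ℕ) : 0 ≤ u + i * δ := add_nonneg hu.1 (by positivity)
  have hstep (i : ℕ) : u + ((i + 1 : ℕ) : ℝ) * δ = u + i * δ + δ := by push_cast; ring
  calc _ ≤ (C + C') * n * (2 + 1 / -(-γ - 1)) * ((k : ℝ) + 1) ^ (-γ - 1) := by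
        refine abs_sum_Ico_le_of_alternating (by positivity) (by linarith) (fun i hi => ?_)
          (fun i hi => ?_) k
        · exact (hK n hn _ (hu0 i) (hle i hi)).trans
            (hrpow i (by linarith) (le_add_of_nonneg_right hC'.le))
        · rw [hstep, show -γ - 1 - 1 = -γ - 2 by ring]
          exact (hK' n hn _ (hu0 i) ((hstep i).symm.trans_le (hle _ hi))).trans
            (hrpow i (by linarith) (le_add_of_nonneg_left hC.le))
    _ = (C + C') * (2 + 1 / -(-γ - 1)) * n * ((k : ℝ) + 1) ^ (-γ - 1) := by ring

end KernelTails

section SummationByParts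

variable {R : Type*} [CommRing R]

/-- Backward differences of a sequence, with the convention that the sequence is preceded by `0`:
this makes the sequence the sequence of partial sums of its differences. -/
def backwardDiff (F : ℕ → R) : ℕ → R
  | 0 => F 0
  | k + 1 => F (k + 1) - F k

/-- Mixed backward differences of a double sequence, with the same convention at `0` as
`backwardDiff`. -/
def mixedDiff (F : ℕ → ℕ → R) (k l : ℕ) : R :=
  backwardDiff (fun k' => backwardDiff (F k') l) k

lemma sum_range_backwardDiff (F : ℕ → R) (n : ℕ) :
    ∑ k ∈ Finset.range (n + 1), backwardDiff F k = F n := by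
  induction n with
  | zero => simp [backwardDiff]
  | succ n ih => rw [Finset.sum_range_succ, ih, backwardDiff, add_sub_cancel]

lemma sum_mul_eq_sum_backwardDiff_mul (F K : ℕ → R) (n : ℕ) :
    ∑ k ∈ Finset.range n, F k * K k =
      ∑ k ∈ Finset.range n, backwardDiff F k * ∑ i ∈ Finset.Ico k n, K i := by
  calc ∑ k ∈ Finset.range n, F k * K k
      = ∑ k ∈ Finset.range n, ∑ j ∈ Finset.range (k + 1), backwardDiff F j * K k := by
        simp only [← Finset.sum_mul, sum_range_backwardDiff]
    _ = ∑ j ∈ Finset.range n, ∑ k ∈ Finset.Ico j n, backwardDiff F j * K k :=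
        Finset.sum_comm' fun k j => by simp only [Finset.mem_range, Finset.mem_Ico]; omega
    _ = _ := by simp only [Finset.mul_sum]

lemma sum_sum_mul_eq_sum_sum_mixedDiff_mul (F : ℕ → ℕ → R) (K K' : ℕ → R) (n m : ℕ) :
    ∑ k ∈ Finset.range n, ∑ l ∈ Finset.range m, F k l * (K k * K' l) =
      ∑ k ∈ Finset.range n, ∑ l ∈ Finset.range m, mixedDiff F k l *
        ((∑ i ∈ Finset.Ico k n, K i) * ∑ j ∈ Finset.Ico l m, K' j) := by
  calc ∑ k ∈ Finset.range n, ∑ l ∈ Finset.range m, F k l * (K k * K' l)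
      = ∑ k ∈ Finset.range n, (∑ l ∈ Finset.range m, F k l * K' l) * K k := by
        simp only [Finset.sum_mul, mul_comm (K _), mul_assoc]
    _ = ∑ l ∈ Finset.range m, (∑ k ∈ Finset.range n, backwardDiff (F k) l * K k) *
          ∑ j ∈ Finset.Ico l m, K' j := by
        simp only [sum_mul_eq_sum_backwardDiff_mul _ K', Finset.sum_mul, mul_right_comm _ _ (K _)]
        exact Finset.sum_comm
    _ = ∑ l ∈ Finset.range m, ∑ k ∈ Finset.range n, mixedDiff F k l *
        ((∑ i ∈ Finset.Ico k n, K i) * ∑ j ∈ Finset.Ico l m, K' j) := by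
        simp only [sum_mul_eq_sum_backwardDiff_mul _ K, Finset.sum_mul, mixedDiff, mul_assoc]
    _ = _ := Finset.sum_comm

lemma mixedDiff_swap (F : ℕ → ℕ → R) (k l : ℕ) :
    mixedDiff (fun l k => F k l) l k = mixedDiff F k l := by
  cases k <;> cases l <;> simp only [mixedDiff, backwardDiff]
  ring

variable [LinearOrder R] [IsStrictOrderedRing R]

lemma abs_backwardDiff_le (F : ℕ → R) (k : ℕ) : |backwardDiff F k| ≤ |F k| + |F (k - 1)| := by
  cases k with
  | zero => simp [backwardDiff]
  | succ k => exact abs_sub _ _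

lemma abs_mixedDiff_le_abs_sub_add (F : ℕ → ℕ → R) {k : ℕ} (hk : 1 ≤ k) (l : ℕ) :
    |mixedDiff F k l| ≤ |F k l - F (k - 1) l| + |F k (l - 1) - F (k - 1) (l - 1)| := by
  obtain ⟨k, rfl⟩ := Nat.exists_eq_add_of_le' hk
  rw [← mixedDiff_swap]
  exact abs_backwardDiff_le (fun l => F (k + 1) l - F k l) l

lemma abs_mixedDiff_le_four_mul {F : ℕ → ℕ → R} {k l : ℕ} {η : R}
    (h : ∀ i ≤ k, ∀ j ≤ l, |F i j| ≤ η) : |mixedDiff F k l| ≤ 4 * η := by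
  have hdiff : ∀ i ≤ k, |backwardDiff (F i) l| ≤ 2 * η := fun i hi => by
    linarith [abs_backwardDiff_le (F i) l, h i hi l le_rfl, h i hi (l - 1) (Nat.sub_le _ _)]
  rw [mixedDiff]
  linarith [abs_backwardDiff_le (fun k' => backwardDiff (F k') l) k, hdiff k le_rfl,
    hdiff (k - 1) (Nat.sub_le _ _)]

end SummationByParts

section Weights

/-- The sums `lam 1 / 1 + ⋯ + lam (j + 1) / (j + 1)`; they dominate `lam` and are summable
against the same power weights. -/
noncomputable def weightSum (lam : ℕ → ℝ) (j : ℕ) : ℝ :=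
  ∑ q ∈ Finset.range (j + 1), lam (q + 1) / ((q : ℝ) + 1)

variable {lam : ℕ → ℝ} {ρ a : ℝ}

lemma mul_rpow_le_mul_rpow_of_antitoneOn_div (hpos : ∀ k, 1 ≤ k → 0 < lam k)
    (hanti : AntitoneOn (fun k : ℕ => lam k / (k : ℝ) ^ (1 - ρ)) (Ici 1))
    {e : ℝ} (he : e ≤ ρ - 1) {p r : ℕ} (hpr : p ≤ r) :
    lam (r + 1) * ((r : ℝ) + 1) ^ e ≤ lam (p + 1) * ((p : ℝ) + 1) ^ e := by
  have hsplit (j : ℕ) : lam (j + 1) * ((j : ℝ) + 1) ^ e =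
      lam (j + 1) / ((j + 1 : ℕ) : ℝ) ^ (1 - ρ) * ((j : ℝ) + 1) ^ (1 - ρ + e) := by
    rw [Real.rpow_add (by positivity : (0 : ℝ) < (j : ℝ) + 1)]
    push_cast
    field_simp
  rw [hsplit, hsplit]
  have hp := hpos (p + 1) (by omega)
  refine mul_le_mul (hanti (mem_Ici.2 (by omega)) (mem_Ici.2 (by omega)) (by omega))
    (Real.rpow_le_rpow_of_nonpos (by positivity) ?_ (by linarith)) (by positivity) (by positivity)
  gcongr

lemma weightSum_nonneg (hpos : ∀ k, 1 ≤ k → 0 < lam k) (j : ℕ) : 0 ≤ weightSum lam j :=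
  Finset.sum_nonneg fun q _ => div_nonneg (hpos _ (by omega)).le (by positivity)

lemma weightSum_mono (hpos : ∀ k, 1 ≤ k → 0 < lam k) : Monotone (weightSum lam) := fun _ _ h =>
  Finset.sum_le_sum_of_subset_of_nonneg (Finset.range_subset_range.2 (by omega)) fun q _ _ =>
    div_nonneg (hpos _ (by omega)).le (by positivity)

lemma le_weightSum (hρ : 0 ≤ ρ) (hpos : ∀ k, 1 ≤ k → 0 < lam k)
    (hanti : AntitoneOn (fun k : ℕ => lam k / (k : ℝ) ^ (1 - ρ)) (Ici 1)) (r : ℕ) :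
    lam (r + 1) ≤ weightSum lam r := by
  have hterm : ∀ q ∈ Finset.range (r + 1),
      lam (r + 1) / ((r : ℝ) + 1) ≤ lam (q + 1) / ((q : ℝ) + 1) := fun q hq => by
    simpa only [Real.rpow_neg_one, ← div_eq_mul_inv] using
      mul_rpow_le_mul_rpow_of_antitoneOn_div hpos hanti (e := -1) (by linarith)
        (Nat.le_of_lt_succ (Finset.mem_range.1 hq))
  calc lam (r + 1) = (r + 1) • (lam (r + 1) / ((r : ℝ) + 1)) := by
        rw [nsmul_eq_mul]
        push_cast
        field_simp
    _ ≤ weightSum lam r := by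
        simpa only [Finset.card_range, weightSum] using Finset.card_nsmul_le_sum _ _ _ hterm

lemma mul_rpow_add_le_weightSum_mul_rpow (ha : 0 ≤ a) (ha1 : a ≤ 1) (haρ : a ≤ ρ)
    (hpos : ∀ k, 1 ≤ k → 0 < lam k)
    (hanti : AntitoneOn (fun k : ℕ => lam k / (k : ℝ) ^ (1 - ρ)) (Ici 1)) (p r : ℕ) :
    lam (r + 1) * ((p : ℝ) + r + 1) ^ (a - 1) ≤ weightSum lam p * ((p : ℝ) + 1) ^ (a - 1) := by
  have hρ : 0 ≤ ρ := ha.trans haρ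
  have hr := hpos (r + 1) (by omega)
  rcases le_total r p with h | h
  · refine mul_le_mul ((le_weightSum hρ hpos hanti r).trans (weightSum_mono hpos h))
      (Real.rpow_le_rpow_of_nonpos (by positivity) ?_ (by linarith)) (by positivity)
      (weightSum_nonneg hpos p)
    linarith [r.cast_nonneg (α := ℝ)]
  · calc lam (r + 1) * ((p : ℝ) + r + 1) ^ (a - 1)
        ≤ lam (r + 1) * ((r : ℝ) + 1) ^ (a - 1) := by
          refine mul_le_mul_of_nonneg_left
            (Real.rpow_le_rpow_of_nonpos (by positivity) ?_ (by linarith)) hr.le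
          linarith [p.cast_nonneg (α := ℝ)]
      _ ≤ lam (p + 1) * ((p : ℝ) + 1) ^ (a - 1) :=
          mul_rpow_le_mul_rpow_of_antitoneOn_div hpos hanti (by linarith) h
      _ ≤ _ := mul_le_mul_of_nonneg_right (le_weightSum hρ hpos hanti p) (by positivity)

lemma sum_mul_le_of_forall_perm_sum_div_le {N : ℕ} {D w μ : Fin N → ℝ} {V M : ℝ}
    (hw : Antitone w) (hD : ∀ i, 0 ≤ D i) (hμ : ∀ i, 0 < μ i) (hM : 0 ≤ M)
    (hμw : ∀ i, μ i * w i ≤ M) (hV : ∀ σ : Equiv.Perm (Fin N), ∑ i, D (σ i) / μ i ≤ V) :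
    ∑ i, D i * w i ≤ V * M := by
  set σ := Tuple.sort (fun i => -D i)
  have hDσ : Antitone (D ∘ σ) := fun i j hij =>
    neg_le_neg_iff.1 (Tuple.monotone_sort (fun i => -D i) hij)
  calc ∑ i, D i * w i
      = ∑ i, D (σ i) * w (σ i) := (Equiv.sum_comp σ (fun i => D i * w i)).symm
    _ ≤ ∑ i, D (σ i) * w i := (hDσ.monovary hw).sum_mul_comp_perm_le_sum_mul (σ := σ)
    _ ≤ ∑ i, D (σ i) / μ i * M := by
        refine Finset.sum_le_sum fun i _ => ?_
        rw [div_mul_eq_mul_div, le_div_iff₀ (hμ i), mul_assoc, mul_comm (w i)]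
        exact mul_le_mul_of_nonneg_left (hμw i) (hD _)
    _ ≤ V * M := by
        rw [← Finset.sum_mul]
        exact mul_le_mul_of_nonneg_right (hV σ) hM

lemma sum_Ico_mul_rpow_le_mul_weightSum (ha : 0 ≤ a) (ha1 : a ≤ 1) (haρ : a ≤ ρ)
    (hpos : ∀ k, 1 ≤ k → 0 < lam k)
    (hanti : AntitoneOn (fun k : ℕ => lam k / (k : ℝ) ^ (1 - ρ)) (Ici 1))
    {d : ℕ → ℝ} (hd : ∀ k, 0 ≤ d k) {p n : ℕ} {V : ℝ}
    (hV : ∀ (N : ℕ) (τ : Fin N → ℕ), Function.Injective τ → (∀ i, p ≤ τ i ∧ τ i < n) →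
      ∑ i, d (τ i) / lam ((i : ℕ) + 1) ≤ V) :
    ∑ k ∈ Finset.Ico p n, d k * ((k : ℝ) + 1) ^ (a - 1) ≤
      V * (weightSum lam p * ((p : ℝ) + 1) ^ (a - 1)) := by
  have hw : Antitone fun i : Fin (n - p) => ((p : ℝ) + (i : ℕ) + 1) ^ (a - 1) := fun i j hij => by
    refine Real.rpow_le_rpow_of_nonpos (by positivity) ?_ (by linarith)
    gcongr
    exact hij
  calc ∑ k ∈ Finset.Ico p n, d k * ((k : ℝ) + 1) ^ (a - 1)
      = ∑ i : Fin (n - p), d (p + i) * ((p : ℝ) + (i : ℕ) + 1) ^ (a - 1) := by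
        rw [Finset.sum_Ico_eq_sum_range,
          Fin.sum_univ_eq_sum_range (fun i => d (p + i) * ((p : ℝ) + i + 1) ^ (a - 1))]
        push_cast
        rfl
    _ ≤ _ := by
        refine sum_mul_le_of_forall_perm_sum_div_le (μ := fun i : Fin (n - p) => lam (i + 1)) hw
          (fun i => hd _) (fun i => hpos _ (by omega))
          (mul_nonneg (weightSum_nonneg hpos p) (by positivity))
          (fun i => mul_rpow_add_le_weightSum_mul_rpow ha ha1 haρ hpos hanti p i)
          fun σ => hV _ (fun i => p + (σ i : ℕ)) (fun i j hij => ?_) fun i => by omega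
        exact σ.injective (Fin.ext (by simpa using hij))

lemma summable_weightSum_mul_rpow (hρ1 : ρ < 1) (hpos : ∀ k, 1 ≤ k → 0 < lam k)
    (hsum : Summable fun k : ℕ => lam (k + 1) / ((k + 1 : ℕ) : ℝ) ^ (2 - ρ)) :
    Summable fun j : ℕ => weightSum lam j * ((j : ℝ) + 1) ^ (ρ - 2) := by
  set c : ℝ := 1 + 1 / (-(ρ - 2) - 1)
  have hc0 : 0 < c := by
    have : 0 < -(ρ - 2) - 1 := by linarith
    positivity
  refine summable_of_sum_range_le (c := c * ∑' k : ℕ, lam (k + 1) / ((k + 1 : ℕ) : ℝ) ^ (2 - ρ))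
    (fun j => mul_nonneg (weightSum_nonneg hpos j) (by positivity)) fun N => ?_
  have hl (q : ℕ) : 0 < lam (q + 1) := hpos _ (by omega)
  calc ∑ j ∈ Finset.range N, weightSum lam j * ((j : ℝ) + 1) ^ (ρ - 2)
      = ∑ j ∈ Finset.range N, ∑ q ∈ Finset.range (j + 1),
          lam (q + 1) / ((q : ℝ) + 1) * ((j : ℝ) + 1) ^ (ρ - 2) := by
        simp only [weightSum, Finset.sum_mul]
    _ = ∑ q ∈ Finset.range N, lam (q + 1) / ((q : ℝ) + 1) *
          ∑ j ∈ Finset.Ico q N, ((j : ℝ) + 1) ^ (ρ - 2) := by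
        simp only [Finset.mul_sum]
        exact Finset.sum_comm' fun j q => by simp only [Finset.mem_range, Finset.mem_Ico]; omega
    _ ≤ ∑ q ∈ Finset.range N, lam (q + 1) / ((q : ℝ) + 1) * (c * ((q : ℝ) + 1) ^ (ρ - 2 + 1)) := by
        refine Finset.sum_le_sum fun q _ => mul_le_mul_of_nonneg_left
          (sum_Ico_add_one_rpow_le (by linarith) q N) (div_nonneg (hl q).le (by positivity))
    _ = c * ∑ q ∈ Finset.range N, lam (q + 1) / ((q + 1 : ℕ) : ℝ) ^ (2 - ρ) := by
        rw [Finset.mul_sum]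
        refine Finset.sum_congr rfl fun q _ => ?_
        have hq : (0 : ℝ) < (q : ℝ) + 1 := by positivity
        push_cast
        rw [Real.rpow_add_one hq.ne', show 2 - ρ = -(ρ - 2) by ring, Real.rpow_neg hq.le]
        field_simp
    _ ≤ _ := by
        refine mul_le_mul_of_nonneg_left (hsum.sum_le_tsum _ fun q _ => ?_) hc0.le
        exact div_nonneg (hl q).le (by positivity)

lemma weightSum_mul_rpow_le_four_mul_sum_Ico (hρ : 0 ≤ ρ) (hρ2 : ρ ≤ 2)
    (hpos : ∀ k, 1 ≤ k → 0 < lam k) (P : ℕ) :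
    weightSum lam P * ((P : ℝ) + 1) ^ (ρ - 1) ≤
      4 * ∑ j ∈ Finset.Ico P (2 * P + 1), weightSum lam j * ((j : ℝ) + 1) ^ (ρ - 2) := by
  have hP : (0 : ℝ) < (P : ℝ) + 1 := by positivity
  have hterm : ∀ j ∈ Finset.Ico P (2 * P + 1),
      weightSum lam P * (((P : ℝ) + 1) ^ (ρ - 2) / 4) ≤
        weightSum lam j * ((j : ℝ) + 1) ^ (ρ - 2) := fun j hj => by
    rw [Finset.mem_Ico] at hj
    refine mul_le_mul (weightSum_mono hpos hj.1) ?_ (by positivity) (weightSum_nonneg hpos j)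
    calc ((P : ℝ) + 1) ^ (ρ - 2) / 4 = 2 ^ (-2 : ℝ) * ((P : ℝ) + 1) ^ (ρ - 2) := by
          rw [Real.rpow_neg (by norm_num)]
          norm_num
          ring
      _ ≤ 2 ^ (ρ - 2) * ((P : ℝ) + 1) ^ (ρ - 2) := by
          gcongr
          · norm_num
          · linarith
      _ = (2 * ((P : ℝ) + 1)) ^ (ρ - 2) := (Real.mul_rpow (by norm_num) hP.le).symm
      _ ≤ ((j : ℝ) + 1) ^ (ρ - 2) := by
          refine Real.rpow_le_rpow_of_nonpos (by positivity) ?_ (by linarith)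
          have : (j : ℝ) + 1 ≤ 2 * P + 1 := by exact_mod_cast hj.2
          linarith
  have hsum := Finset.card_nsmul_le_sum _ _ _ hterm
  rw [Nat.card_Ico, nsmul_eq_mul, show 2 * P + 1 - P = P + 1 by omega] at hsum
  push_cast at hsum
  rw [show ρ - 1 = ρ - 2 + 1 by ring, Real.rpow_add_one hP.ne']
  linarith

lemma exists_forall_sum_Ico_weightSum_mul_rpow_le (hρ : 0 ≤ ρ) (hρ1 : ρ < 1)
    (hpos : ∀ k, 1 ≤ k → 0 < lam k)
    (hsum : Summable fun k : ℕ => lam (k + 1) / ((k + 1 : ℕ) : ℝ) ^ (2 - ρ)) {ε : ℝ} (hε : 0 < ε) :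
    ∃ P : ℕ, 1 ≤ P ∧ (∀ m, ∑ j ∈ Finset.Ico P m, weightSum lam j * ((j : ℝ) + 1) ^ (ρ - 2) ≤ ε) ∧
      weightSum lam P * ((P : ℝ) + 1) ^ (ρ - 1) ≤ ε := by
  have hs := summable_weightSum_mul_rpow hρ1 hpos hsum
  obtain ⟨P, hP, hP1⟩ := (((tendsto_sum_nat_add
    fun j => weightSum lam j * ((j : ℝ) + 1) ^ (ρ - 2)).eventually
    (gt_mem_nhds (show 0 < ε / 4 by positivity))).and (eventually_ge_atTop 1)).exists
  have htail (m : ℕ) :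
      ∑ j ∈ Finset.Ico P m, weightSum lam j * ((j : ℝ) + 1) ^ (ρ - 2) ≤ ε / 4 := by
    rw [Finset.sum_Ico_eq_sum_range]
    refine le_trans ?_ hP.le
    simp only [add_comm P]
    exact ((summable_nat_add_iff P).2 hs).sum_le_tsum _ fun j _ =>
      mul_nonneg (weightSum_nonneg hpos _) (by positivity)
  exact ⟨P, hP1, fun m => (htail m).trans (by linarith),
    (weightSum_mul_rpow_le_four_mul_sum_Ico hρ (by linarith) hpos P).trans
      (by linarith [htail (2 * P + 1)])⟩

end Weights

section DoubleSum

variable {lam : ℕ → ℝ} {a b ε : ℝ} {P : ℕ}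

lemma sum_rpow_mul_weightSum_max_le (hb : 0 < b) (hb1 : b ≤ 1)
    (hpos : ∀ k, 1 ≤ k → 0 < lam k)
    (htail : ∀ m, ∑ j ∈ Finset.Ico P m, weightSum lam j * ((j : ℝ) + 1) ^ (a + b - 2) ≤ ε)
    (hhead : weightSum lam P * ((P : ℝ) + 1) ^ (a + b - 1) ≤ ε) (m : ℕ) :
    ∑ l ∈ Finset.range m, ((l : ℝ) + 1) ^ (b - 1) *
      (weightSum lam (max l P) * (((max l P : ℕ) : ℝ) + 1) ^ (a - 1)) ≤ (1 / b + 1) * ε := by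
  set g : ℕ → ℝ := fun l => ((l : ℝ) + 1) ^ (b - 1) *
    (weightSum lam (max l P) * (((max l P : ℕ) : ℝ) + 1) ^ (a - 1)) with hg
  have hW (j : ℕ) : 0 ≤ weightSum lam j * ((j : ℝ) + 1) ^ (a - 1) :=
    mul_nonneg (weightSum_nonneg hpos j) (by positivity)
  have hfirst : ∑ l ∈ Finset.range P, g l ≤ 1 / b * ε := by
    calc ∑ l ∈ Finset.range P, g l = (∑ l ∈ Finset.range P, ((l : ℝ) + 1) ^ (b - 1)) *
          (weightSum lam P * ((P : ℝ) + 1) ^ (a - 1)) := by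
          rw [Finset.sum_mul]
          refine Finset.sum_congr rfl fun l hl => ?_
          simp only [hg]
          rw [max_eq_right (Finset.mem_range.1 hl).le]
      _ ≤ ((P : ℝ) + 1) ^ b / b * (weightSum lam P * ((P : ℝ) + 1) ^ (a - 1)) := by
          refine mul_le_mul_of_nonneg_right
            ((sum_range_add_one_rpow_le (by linarith) (by linarith) P).trans ?_) (hW P)
          rw [sub_add_cancel]
          gcongr
          linarith
      _ = 1 / b * (weightSum lam P * ((P : ℝ) + 1) ^ (a + b - 1)) := by
          rw [show a + b - 1 = b + (a - 1) by ring, Real.rpow_add (by positivity)]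
          ring
      _ ≤ 1 / b * ε := by gcongr
  have hsecond : ∑ l ∈ Finset.Ico P (P + m), g l ≤ ε := by
    refine le_trans (Finset.sum_congr rfl fun l hl => ?_).le (htail (P + m))
    simp only [hg]
    rw [max_eq_left (Finset.mem_Ico.1 hl).1, show a + b - 2 = (b - 1) + (a - 1) by ring,
      Real.rpow_add (by positivity)]
    ring
  calc ∑ l ∈ Finset.range m, g l ≤ ∑ l ∈ Finset.range (P + m), g l :=
        Finset.sum_le_sum_of_subset_of_nonneg (Finset.range_subset_range.2 (by omega))
          fun l _ _ => mul_nonneg (by positivity) (hW _)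
    _ = ∑ l ∈ Finset.range P, g l + ∑ l ∈ Finset.Ico P (P + m), g l :=
        (Finset.sum_range_add_sum_Ico _ (Nat.le_add_right P m)).symm
    _ ≤ (1 / b + 1) * ε := by linarith

lemma sum_range_sum_Ico_abs_mixedDiff_mul_rpow_le (hb : 0 < b) (hb1 : b ≤ 1)
    (hpos : ∀ k, 1 ≤ k → 0 < lam k) (hP : 1 ≤ P)
    (htail : ∀ m, ∑ j ∈ Finset.Ico P m, weightSum lam j * ((j : ℝ) + 1) ^ (a + b - 2) ≤ ε)
    (hhead : weightSum lam P * ((P : ℝ) + 1) ^ (a + b - 1) ≤ ε)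
    {F : ℕ → ℕ → ℝ} {n m : ℕ} {V : ℝ} (hV0 : 0 ≤ V)
    (hV : ∀ l < m, ∀ p, 1 ≤ p → ∑ k ∈ Finset.Ico p n, |F k l - F (k - 1) l| *
      ((k : ℝ) + 1) ^ (a - 1) ≤ V * (weightSum lam p * ((p : ℝ) + 1) ^ (a - 1))) :
    ∑ l ∈ Finset.range m, ∑ k ∈ Finset.Ico (max l P) n,
      |mixedDiff F k l| * (((k : ℝ) + 1) ^ (a - 1) * ((l : ℝ) + 1) ^ (b - 1)) ≤
        2 * V * ((1 / b + 1) * ε) := by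
  have hrow : ∀ l ∈ Finset.range m, ∑ k ∈ Finset.Ico (max l P) n,
      |mixedDiff F k l| * (((k : ℝ) + 1) ^ (a - 1) * ((l : ℝ) + 1) ^ (b - 1)) ≤
        2 * V * (((l : ℝ) + 1) ^ (b - 1) *
          (weightSum lam (max l P) * (((max l P : ℕ) : ℝ) + 1) ^ (a - 1))) := fun l hl => by
    have hl' := Finset.mem_range.1 hl
    have hp : 1 ≤ max l P := hP.trans (le_max_right _ _)
    calc _ ≤ ∑ k ∈ Finset.Ico (max l P) n, (|F k l - F (k - 1) l| * ((k : ℝ) + 1) ^ (a - 1) +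
          |F k (l - 1) - F (k - 1) (l - 1)| * ((k : ℝ) + 1) ^ (a - 1)) *
            ((l : ℝ) + 1) ^ (b - 1) := by
          refine Finset.sum_le_sum fun k hk => ?_
          rw [← mul_assoc, ← add_mul]
          gcongr
          exact abs_mixedDiff_le_abs_sub_add F (hp.trans (Finset.mem_Ico.1 hk).1) l
      _ ≤ (V * (weightSum lam (max l P) * (((max l P : ℕ) : ℝ) + 1) ^ (a - 1)) +
          V * (weightSum lam (max l P) * (((max l P : ℕ) : ℝ) + 1) ^ (a - 1))) *
            ((l : ℝ) + 1) ^ (b - 1) := by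
          rw [← Finset.sum_mul, Finset.sum_add_distrib]
          gcongr
          exacts [hV l hl' _ hp, hV (l - 1) (by omega) _ hp]
      _ = _ := by ring
  refine (Finset.sum_le_sum hrow).trans ?_
  rw [← Finset.mul_sum]
  exact mul_le_mul_of_nonneg_left (sum_rpow_mul_weightSum_max_le hb hb1 hpos htail hhead m)
    (by positivity)

lemma sum_range_sum_range_le_sum_Ico_max {t : ℕ → ℕ → ℝ} (ht : ∀ k l, 0 ≤ t k l) (P n m : ℕ) :
    ∑ k ∈ Finset.range n, ∑ l ∈ Finset.range m, t k l ≤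
      ∑ l ∈ Finset.range m, ∑ k ∈ Finset.Ico (max l P) n, t k l +
      ∑ k ∈ Finset.range n, ∑ l ∈ Finset.Ico (max k P) m, t k l +
      ∑ k ∈ Finset.range P, ∑ l ∈ Finset.range P, t k l := by
  have hIco (p q : ℕ) : Finset.Ico p q = (Finset.range q).filter (p ≤ ·) := by
    ext i
    simp only [Finset.mem_Ico, Finset.mem_filter, Finset.mem_range, and_comm]
  have hcorner : ∑ k ∈ Finset.range n, ∑ l ∈ Finset.range m, (if k < P ∧ l < P then t k l else 0) ≤
      ∑ k ∈ Finset.range P, ∑ l ∈ Finset.range P, t k l := by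
    rw [← Finset.sum_product', ← Finset.sum_product', ← Finset.sum_filter]
    refine Finset.sum_le_sum_of_subset_of_nonneg (fun x hx => ?_) fun _ _ _ => ht _ _
    simp only [Finset.mem_filter, Finset.mem_product, Finset.mem_range] at hx ⊢
    exact hx.2
  refine le_trans ?_ (add_le_add_right hcorner _)
  simp only [hIco, Finset.sum_filter]
  rw [Finset.sum_comm (s := Finset.range m)]
  simp only [← Finset.sum_add_distrib]
  refine Finset.sum_le_sum fun k _ => Finset.sum_le_sum fun l _ => ?_
  have := ht k l
  split_ifs <;> first | linarith | omega

lemma sum_corner_abs_mixedDiff_mul_rpow_le (ha1 : a ≤ 1) (hb1 : b ≤ 1) {F : ℕ → ℕ → ℝ} {η : ℝ}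
    (hF : ∀ k < P, ∀ l < P, |F k l| ≤ η) :
    ∑ k ∈ Finset.range P, ∑ l ∈ Finset.range P,
      |mixedDiff F k l| * (((k : ℝ) + 1) ^ (a - 1) * ((l : ℝ) + 1) ^ (b - 1)) ≤
        4 * P ^ 2 * η := by
  have hrpow {c : ℝ} (hc : c ≤ 1) (k : ℕ) : ((k : ℝ) + 1) ^ (c - 1) ≤ 1 :=
    Real.rpow_le_one_of_one_le_of_nonpos (by linarith [k.cast_nonneg (α := ℝ)]) (by linarith)
  calc _ ≤ ∑ k ∈ Finset.range P, ∑ l ∈ Finset.range P, 4 * η := by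
        refine Finset.sum_le_sum fun k hk => Finset.sum_le_sum fun l hl => ?_
        rw [Finset.mem_range] at hk hl
        have hη : |mixedDiff F k l| ≤ 4 * η :=
          abs_mixedDiff_le_four_mul fun i hi j hj => hF i (by omega) j (by omega)
        refine (mul_le_of_le_one_right (abs_nonneg _) ?_).trans hη
        exact mul_le_one₀ (hrpow ha1 k) (by positivity) (hrpow hb1 l)
    _ = 4 * P ^ 2 * η := by
        simp only [Finset.sum_const, Finset.card_range, nsmul_eq_mul]
        ring

lemma exists_forall_sum_abs_mixedDiff_mul_rpow_le (ha : a ∈ Ioo (0 : ℝ) 1)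
    (hb : b ∈ Ioo (0 : ℝ) 1) (hab : a + b < 1) (hpos : ∀ k, 1 ≤ k → 0 < lam k)
    (hsum : Summable fun k : ℕ => lam (k + 1) / ((k + 1 : ℕ) : ℝ) ^ (2 - (a + b))) (hε : 0 < ε) :
    ∃ P : ℕ, 1 ≤ P ∧ ∀ (F : ℕ → ℕ → ℝ) (n m : ℕ) (V η : ℝ), 0 ≤ V →
      (∀ l < m, ∀ p, 1 ≤ p → ∑ k ∈ Finset.Ico p n, |F k l - F (k - 1) l| *
        ((k : ℝ) + 1) ^ (a - 1) ≤ V * (weightSum lam p * ((p : ℝ) + 1) ^ (a - 1))) →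
      (∀ k < n, ∀ p, 1 ≤ p → ∑ l ∈ Finset.Ico p m, |F k l - F k (l - 1)| *
        ((l : ℝ) + 1) ^ (b - 1) ≤ V * (weightSum lam p * ((p : ℝ) + 1) ^ (b - 1))) →
      (∀ k < P, ∀ l < P, |F k l| ≤ η) →
      ∑ k ∈ Finset.range n, ∑ l ∈ Finset.range m,
        |mixedDiff F k l| * (((k : ℝ) + 1) ^ (a - 1) * ((l : ℝ) + 1) ^ (b - 1)) ≤
          4 * P ^ 2 * η + V * ε := by
  obtain ⟨ha0, ha1⟩ := ha
  obtain ⟨hb0, hb1⟩ := hb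
  set c : ℝ := 2 * (1 / b + 1) + 2 * (1 / a + 1) with hc
  have hc0 : 0 < c := by positivity
  obtain ⟨P, hP, htail, hhead⟩ := exists_forall_sum_Ico_weightSum_mul_rpow_le (by linarith) hab
    hpos hsum (div_pos hε hc0)
  refine ⟨P, hP, fun F n m V η hV hrow hcol hsmall => ?_⟩
  have hbelow := sum_range_sum_Ico_abs_mixedDiff_mul_rpow_le hb0 hb1.le hpos hP htail hhead hV hrow
  have habove := sum_range_sum_Ico_abs_mixedDiff_mul_rpow_le (F := fun l k => F k l) (a := b)
    (b := a) (n := m) (m := n) ha0 ha1.le hpos hP (by simpa only [add_comm b a] using htail)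
    (by simpa only [add_comm b a] using hhead) hV hcol
  simp only [mixedDiff_swap, mul_comm (((_ : ℕ) + 1 : ℝ) ^ (b - 1))] at habove
  calc _ ≤ 2 * V * ((1 / b + 1) * (ε / c)) + 2 * V * ((1 / a + 1) * (ε / c)) + 4 * P ^ 2 * η :=
        (sum_range_sum_range_le_sum_Ico_max (fun k l => by positivity) P n m).trans
          (add_le_add (add_le_add hbelow habove)
            (sum_corner_abs_mixedDiff_mul_rpow_le ha1.le hb1.le hsmall))
    _ = 4 * P ^ 2 * η + V * (c * (ε / c)) := by rw [hc]; ring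
    _ = 4 * P ^ 2 * η + V * ε := by rw [mul_div_cancel₀ _ hc0.ne']

end DoubleSum

section Variation

variable {lam : ℕ → ℝ} {g : ℝ → ℝ} {V : ℝ}

/-- The `Λ`-variation of `g` over every window of length `2π` is at most `V`. Unlike `lambdaVar`,
which only sees `[0, 2π]`, this is invariant under translations and reflections of `g`. -/
def VariationLE (lam : ℕ → ℝ) (V : ℝ) (g : ℝ → ℝ) : Prop :=
  ∀ (c : ℝ) (N : ℕ) (a b : Fin N → ℝ), (∀ i, c ≤ a i ∧ a i < b i ∧ b i ≤ c + 2 * Real.pi) →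
    (Pairwise fun i j => b i ≤ a j ∨ b j ≤ a i) →
    ∑ i, |g (b i) - g (a i)| / lam ((i : ℕ) + 1) ≤ V

lemma sum_abs_sub_div_le_of_lambdaVar_le (hpos : ∀ k, 1 ≤ k → 0 < lam k) (hV0 : 0 ≤ V)
    (hV : lambdaVar lam g ≤ ENNReal.ofReal V) {N : ℕ} {a b : Fin N → ℝ}
    (hab : ∀ i, 0 ≤ a i ∧ a i < b i ∧ b i ≤ 2 * Real.pi)
    (hdis : Pairwise fun i j => b i ≤ a j ∨ b j ≤ a i) :
    ∑ i, |g (b i) - g (a i)| / lam ((i : ℕ) + 1) ≤ V := by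
  have hno : Nonoverlapping a b := ⟨hab, fun i j hij => by
    have : b i ≤ a j ∨ b j ≤ a i := hdis hij
    simp only [Set.Ioo_disjoint_Ioo, min_le_iff, le_max_iff]
    tauto⟩
  refine (ENNReal.ofReal_le_ofReal_iff hV0).1 (le_trans ?_ hV)
  rw [ENNReal.ofReal_sum_of_nonneg fun i _ => div_nonneg (abs_nonneg _) (hpos _ (by omega)).le]
  exact le_iSup_of_le N (le_iSup_of_le a (le_iSup_of_le b (le_iSup_of_le hno le_rfl)))

/- A family in `[c, c + 2π]` with `0 ≤ c < 2π` has at most one member containing `2π` in its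
interior. In the next two lemmas that member is truncated at `2π` and the members on one side of
`2π` are moved into the free part of `[0, 2π]`; no member is dropped, which would change the
weights of the others. -/
lemma sum_abs_sub_min_div_le (hpos : ∀ k, 1 ≤ k → 0 < lam k) (hV0 : 0 ≤ V)
    (hV : lambdaVar lam g ≤ ENNReal.ofReal V) (hg : Function.Periodic g (2 * Real.pi)) {c : ℝ}
    (hc : c ∈ Ico 0 (2 * Real.pi)) {N : ℕ} {a b : Fin N → ℝ}
    (hab : ∀ i, c ≤ a i ∧ a i < b i ∧ b i ≤ c + 2 * Real.pi)
    (hdis : Pairwise fun i j => b i ≤ a j ∨ b j ≤ a i) :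
    ∑ i, |g (if 2 * Real.pi ≤ a i then b i else min (b i) (2 * Real.pi)) - g (a i)| /
      lam ((i : ℕ) + 1) ≤ V := by
  obtain ⟨hc0, hc1⟩ := hc
  refine le_trans (Finset.sum_le_sum fun i _ => le_of_eq ?_)
    (sum_abs_sub_div_le_of_lambdaVar_le hpos hV0 hV
      (a := fun i => if 2 * Real.pi ≤ a i then a i - 2 * Real.pi else a i)
      (b := fun i => if 2 * Real.pi ≤ a i then b i - 2 * Real.pi else min (b i) (2 * Real.pi))
      (fun i => ?_) fun i j hij => ?_)
  · split_ifs <;> simp only [hg.sub_eq]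
  · have := hab i
    split_ifs <;> grind
  · have := hab i
    have := hab j
    have : b i ≤ a j ∨ b j ≤ a i := hdis hij
    dsimp only
    split_ifs <;> grind

lemma sum_abs_sub_max_div_le (hpos : ∀ k, 1 ≤ k → 0 < lam k) (hV0 : 0 ≤ V)
    (hV : lambdaVar lam g ≤ ENNReal.ofReal V) (hg : Function.Periodic g (2 * Real.pi)) {c : ℝ}
    (hc : c ∈ Ico 0 (2 * Real.pi)) {N : ℕ} {a b : Fin N → ℝ}
    (hab : ∀ i, c ≤ a i ∧ a i < b i ∧ b i ≤ c + 2 * Real.pi)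
    (hdis : Pairwise fun i j => b i ≤ a j ∨ b j ≤ a i) :
    ∑ i, |g (b i) - g (if b i ≤ 2 * Real.pi then a i else max (a i) (2 * Real.pi))| /
      lam ((i : ℕ) + 1) ≤ V := by
  obtain ⟨hc0, hc1⟩ := hc
  refine le_trans (Finset.sum_le_sum fun i _ => le_of_eq ?_)
    (sum_abs_sub_div_le_of_lambdaVar_le hpos hV0 hV
      (a := fun i => if b i ≤ 2 * Real.pi then a i else max (a i) (2 * Real.pi) - 2 * Real.pi)
      (b := fun i => if b i ≤ 2 * Real.pi then b i else b i - 2 * Real.pi)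
      (fun i => ?_) fun i j hij => ?_)
  · split_ifs <;> simp only [hg.sub_eq]
  · have := hab i
    split_ifs <;> grind
  · have := hab i
    have := hab j
    have : b i ≤ a j ∨ b j ≤ a i := hdis hij
    dsimp only
    split_ifs <;> grind

lemma variationLE_of_lambdaVar_le (hpos : ∀ k, 1 ≤ k → 0 < lam k) (hV0 : 0 ≤ V)
    (hV : lambdaVar lam g ≤ ENNReal.ofReal V) (hg : Function.Periodic g (2 * Real.pi)) :
    VariationLE lam (2 * V) g := by
  intro c N a b hab hdis
  wlog hc : c ∈ Ico 0 (2 * Real.pi) generalizing c a b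
  · obtain ⟨z, hz, -⟩ := existsUnique_add_zsmul_mem_Ico Real.two_pi_pos c 0
    rw [zero_add] at hz
    have := this (c + z • (2 * Real.pi)) (fun i => a i + z • (2 * Real.pi))
      (fun i => b i + z • (2 * Real.pi))
      (fun i => ⟨by linarith [(hab i).1], by linarith [(hab i).2.1], by linarith [(hab i).2.2]⟩)
      (fun i j hij => by simpa using hdis hij) hz
    simpa only [hg.zsmul z _] using this
  refine le_trans ?_ (add_le_add (sum_abs_sub_min_div_le hpos hV0 hV hg hc hab hdis)
    (sum_abs_sub_max_div_le hpos hV0 hV hg hc hab hdis)) |>.trans_eq (two_mul V).symm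
  rw [← Finset.sum_add_distrib]
  refine Finset.sum_le_sum fun i _ => ?_
  rw [← add_div, div_le_div_iff_of_pos_right (hpos _ (by omega))]
  rcases le_or_gt (b i) (2 * Real.pi) with hb | hb
  · simp only [if_pos hb]
    exact le_add_of_nonneg_left (abs_nonneg _)
  rcases le_or_gt (2 * Real.pi) (a i) with ha | ha
  · simp only [if_pos ha]
    exact le_add_of_nonneg_right (abs_nonneg _)
  rw [if_neg hb.not_ge, if_neg ha.not_ge, min_eq_right hb.le, max_eq_right ha.le, add_comm]
  exact abs_sub_le _ _ _

lemma VariationLE.comp_add_smul (hg : VariationLE lam V g) (x : ℝ) (σ : ℤˣ) :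
    VariationLE lam V fun s => g (x + σ • s) := by
  intro c N a b hab hdis
  rcases Int.units_eq_one_or σ with rfl | rfl
  · simp only [one_smul]
    exact hg (x + c) N (fun i => x + a i) (fun i => x + b i)
      (fun i => by have := hab i; constructor <;> grind) fun i j hij => by simpa using hdis hij
  · simp only [Units.neg_smul, one_smul, fun i => abs_sub_comm (g (x + -b i))]
    exact hg (x - c - 2 * Real.pi) N (fun i => x + -b i) (fun i => x + -a i)
      (fun i => by have := hab i; constructor <;> grind)
      fun i j hij => by
        have : b i ≤ a j ∨ b j ≤ a i := hdis hij
        grind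

lemma VariationLE.sub_const (hg : VariationLE lam V g) (L : ℝ) :
    VariationLE lam V fun s => g s - L := by
  simpa only [VariationLE, sub_sub_sub_cancel_right] using hg

lemma VariationLE.sum_grid_le (hg : VariationLE lam V g) {n : ℕ} (hn : 1 ≤ n) {u : ℝ}
    (hu : u ∈ Icc 0 (Real.pi / n)) {N : ℕ} {τ : Fin N → ℕ} (hτ : Function.Injective τ)
    (hτn : ∀ i, 1 ≤ τ i ∧ τ i < n) :
    ∑ i, |g (u + τ i * (Real.pi / n)) - g (u + (τ i - 1 : ℕ) * (Real.pi / n))| /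
      lam ((i : ℕ) + 1) ≤ V := by
  have : (0 : ℝ) < n := by exact_mod_cast hn
  have hh : 0 < Real.pi / n := by positivity
  have hle {p q : ℕ} (h : p + 1 ≤ q) :
      u + p * (Real.pi / n) + Real.pi / n ≤ u + q * (Real.pi / n) := by
    have : (p : ℝ) + 1 ≤ q := by exact_mod_cast h
    nlinarith
  refine hg 0 N (fun i => u + (τ i - 1 : ℕ) * (Real.pi / n)) (fun i => u + τ i * (Real.pi / n))
    (fun i => ⟨by have := hu.1; positivity, ?_, ?_⟩) fun i j hij => ?_
  · linarith [hle (show τ i - 1 + 1 ≤ τ i from (Nat.sub_add_cancel (hτn i).1).le)]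
  · have hend : n * (Real.pi / n) = Real.pi := by field_simp
    linarith [hle (hτn i).2, hu.2, Real.pi_pos, div_le_self Real.pi_pos.le
      (by exact_mod_cast hn : (1 : ℝ) ≤ n)]
  · rcases lt_or_gt_of_ne (hτ.ne hij) with h | h
    · left
      gcongr
      omega
    · right
      gcongr
      omega

end Variation

section Slices

variable {lam : ℕ → ℝ} {f : ℝ × ℝ → ℝ}

lemma lambdaVar_fst_le_lambdaVar₁ (hper : Periodic2 f) (y : ℝ) :
    lambdaVar lam (fun x => f (x, y)) ≤ lambdaVar₁ lam f := by
  obtain ⟨z, hz, -⟩ := existsUnique_add_zsmul_mem_Ico Real.two_pi_pos y 0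
  rw [zero_add] at hz
  have hshift : (fun x => f (x, y)) = fun x => f (x, y + z • (2 * Real.pi)) := funext fun x =>
    (Function.Periodic.zsmul (f := fun y => f (x, y)) (hper.2 x) z y).symm
  rw [hshift]
  exact le_iSup₂_of_le (f := fun y (_ : y ∈ Icc 0 (2 * Real.pi)) => lambdaVar lam fun x => f (x, y))
    _ (Ico_subset_Icc_self hz) le_rfl

lemma lambdaVar_snd_le_lambdaVar₂ (hper : Periodic2 f) (x : ℝ) :
    lambdaVar lam (fun y => f (x, y)) ≤ lambdaVar₂ lam f :=
  lambdaVar_fst_le_lambdaVar₁ (f := f ∘ Prod.swap)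
    ⟨fun a b => hper.2 b a, fun a b => hper.1 b a⟩ x

lemma exists_forall_variationLE (hpos : ∀ k, 1 ≤ k → 0 < lam k) (hper : Periodic2 f)
    (hf : BoundedPartialVar lam f) :
    ∃ V ≥ 0, (∀ y, VariationLE lam V fun x => f (x, y)) ∧
      ∀ x, VariationLE lam V fun y => f (x, y) := by
  have hV0 : 0 ≤ (lambdaVar₁ lam f + lambdaVar₂ lam f).toReal := ENNReal.toReal_nonneg
  have hV := ENNReal.ofReal_toReal hf.ne
  exact ⟨2 * (lambdaVar₁ lam f + lambdaVar₂ lam f).toReal, by positivity,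
    fun y => variationLE_of_lambdaVar_le hpos hV0
      (((lambdaVar_fst_le_lambdaVar₁ hper y).trans le_self_add).trans_eq hV.symm) (hper.1 · y),
    fun x => variationLE_of_lambdaVar_le hpos hV0
      (((lambdaVar_snd_le_lambdaVar₂ hper x).trans le_add_self).trans_eq hV.symm) (hper.2 x)⟩

end Slices

section Grid

variable {lam : ℕ → ℝ} {α β ε V : ℝ}

lemma VariationLE.sum_Ico_grid_mul_rpow_le {ρ a : ℝ} {g : ℝ → ℝ} (hg : VariationLE lam V g)
    (ha : 0 ≤ a) (ha1 : a ≤ 1) (haρ : a ≤ ρ) (hpos : ∀ k, 1 ≤ k → 0 < lam k)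
    (hanti : AntitoneOn (fun k : ℕ => lam k / (k : ℝ) ^ (1 - ρ)) (Ici 1))
    {n : ℕ} (hn : 1 ≤ n) {u : ℝ} (hu : u ∈ Icc 0 (Real.pi / n)) {p : ℕ} (hp : 1 ≤ p) :
    ∑ k ∈ Finset.Ico p n,
      |g (u + k * (Real.pi / n)) - g (u + (k - 1 : ℕ) * (Real.pi / n))| *
        ((k : ℝ) + 1) ^ (a - 1) ≤ V * (weightSum lam p * ((p : ℝ) + 1) ^ (a - 1)) :=
  sum_Ico_mul_rpow_le_mul_weightSum
    (d := fun k => |g (u + k * (Real.pi / n)) - g (u + (k - 1 : ℕ) * (Real.pi / n))|)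
    ha ha1 haρ hpos hanti (fun _ => abs_nonneg _) fun _ _ hτ hτn =>
      hg.sum_grid_le hn hu hτ fun i => ⟨hp.trans (hτn i).1, (hτn i).2⟩

lemma abs_sum_sum_mul_le_sum_abs_mixedDiff {n m : ℕ} {κ κ' : ℕ → ℝ} {C C' : ℝ}
    (hκ : ∀ k, |∑ i ∈ Finset.Ico k n, κ i| ≤ C * ((k : ℝ) + 1) ^ (α - 1))
    (hκ' : ∀ l, |∑ j ∈ Finset.Ico l m, κ' j| ≤ C' * ((l : ℝ) + 1) ^ (β - 1))
    (F : ℕ → ℕ → ℝ) :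
    |∑ k ∈ Finset.range n, ∑ l ∈ Finset.range m, F k l * (κ k * κ' l)| ≤
      C * C' * ∑ k ∈ Finset.range n, ∑ l ∈ Finset.range m,
        |mixedDiff F k l| * (((k : ℝ) + 1) ^ (α - 1) * ((l : ℝ) + 1) ^ (β - 1)) := by
  rw [sum_sum_mul_eq_sum_sum_mixedDiff_mul]
  simp only [Finset.mul_sum (Finset.range _)]
  refine (Finset.abs_sum_le_sum_abs _ _).trans (Finset.sum_le_sum fun k _ =>
    (Finset.abs_sum_le_sum_abs _ _).trans (Finset.sum_le_sum fun l _ => ?_))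
  rw [abs_mul, abs_mul]
  calc _ ≤ |mixedDiff F k l| *
        ((C * ((k : ℝ) + 1) ^ (α - 1)) * (C' * ((l : ℝ) + 1) ^ (β - 1))) := by
        gcongr
        exacts [(abs_nonneg _).trans (hκ k), hκ k, hκ' l]
    _ = _ := by ring

lemma exists_sum_abs_mixedDiff_grid_le (hα : α ∈ Ioo (0 : ℝ) 1) (hβ : β ∈ Ioo (0 : ℝ) 1)
    (hαβ : α + β < 1) (hpos : ∀ k, 1 ≤ k → 0 < lam k)
    (hanti : AntitoneOn (fun k : ℕ => lam k / (k : ℝ) ^ (1 - (α + β))) (Ici 1))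
    (hsum : Summable fun k : ℕ => lam (k + 1) / ((k + 1 : ℕ) : ℝ) ^ (2 - (α + β)))
    (hV : 0 ≤ V) (hε : 0 < ε) :
    ∃ η > 0, ∃ P : ℕ, ∀ φ : ℝ → ℝ → ℝ, (∀ t, VariationLE lam V fun s => φ s t) →
      (∀ s, VariationLE lam V (φ s)) → ∀ n m : ℕ, 1 ≤ n → 1 ≤ m →
      (∀ s ∈ Ioc 0 (P * (Real.pi / n)), ∀ t ∈ Ioc 0 (P * (Real.pi / m)), |φ s t| ≤ η) →
      ∀ u ∈ Ioc 0 (Real.pi / n), ∀ v ∈ Ioc 0 (Real.pi / m),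
      ∑ k ∈ Finset.range n, ∑ l ∈ Finset.range m,
        |mixedDiff (fun k l => φ (u + k * (Real.pi / n)) (v + l * (Real.pi / m))) k l| *
          (((k : ℝ) + 1) ^ (α - 1) * ((l : ℝ) + 1) ^ (β - 1)) ≤ ε := by
  obtain ⟨P, hP, hmain⟩ := exists_forall_sum_abs_mixedDiff_mul_rpow_le hα hβ hαβ hpos hsum
    (ε := ε / (2 * (V + 1))) (by positivity)
  have : (0 : ℝ) < P := by exact_mod_cast hP
  refine ⟨ε / (2 * (4 * P ^ 2)), by positivity, P, fun φ h₁ h₂ n m hn hm hsmall u hu v hv => ?_⟩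
  have hgrid {q : ℕ} {w : ℝ} (hw : w ∈ Ioc 0 (Real.pi / q)) {k : ℕ} (hk : k < P) :
      w + k * (Real.pi / q) ∈ Ioc 0 (P * (Real.pi / q)) := by
    have hk' : (k : ℝ) + 1 ≤ P := by exact_mod_cast hk
    refine ⟨by have := hw.1; positivity, ?_⟩
    calc w + k * (Real.pi / q) ≤ (k + 1) * (Real.pi / q) := by linarith [hw.2]
      _ ≤ P * (Real.pi / q) := by gcongr
  calc _ ≤ 4 * P ^ 2 * (ε / (2 * (4 * P ^ 2))) + V * (ε / (2 * (V + 1))) :=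
        hmain _ n m V _ hV
          (fun l _ p hp => (h₁ _).sum_Ico_grid_mul_rpow_le hα.1.le hα.2.le (by linarith [hβ.1])
            hpos hanti hn (Ioc_subset_Icc_self hu) hp)
          (fun k _ p hp => (h₂ _).sum_Ico_grid_mul_rpow_le hβ.1.le hβ.2.le (by linarith [hα.1])
            hpos hanti hm (Ioc_subset_Icc_self hv) hp)
          fun k hk l hl => hsmall _ (hgrid hu hk) _ (hgrid hv hl)
    _ = ε / 2 + V / (V + 1) * (ε / 2) := by field_simp
    _ ≤ ε / 2 + 1 * (ε / 2) := by
        gcongr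
        exact div_le_one_of_le₀ (by linarith) (by linarith)
    _ = ε := by ring

lemma exists_abs_sum_grid_mul_cesaroKernel_le (hα : α ∈ Ioo (0 : ℝ) 1) (hβ : β ∈ Ioo (0 : ℝ) 1)
    (hαβ : α + β < 1) (hpos : ∀ k, 1 ≤ k → 0 < lam k)
    (hanti : AntitoneOn (fun k : ℕ => lam k / (k : ℝ) ^ (1 - (α + β))) (Ici 1))
    (hsum : Summable fun k : ℕ => lam (k + 1) / ((k + 1 : ℕ) : ℝ) ^ (2 - (α + β)))
    (hV : 0 ≤ V) (hε : 0 < ε) :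
    ∃ η > 0, ∃ P : ℕ, ∀ φ : ℝ → ℝ → ℝ, (∀ t, VariationLE lam V fun s => φ s t) →
      (∀ s, VariationLE lam V (φ s)) → ∀ n m : ℕ, 1 ≤ n → 1 ≤ m →
      (∀ s ∈ Ioc 0 (P * (Real.pi / n)), ∀ t ∈ Ioc 0 (P * (Real.pi / m)), |φ s t| ≤ η) →
      ∀ u ∈ Ioc 0 (Real.pi / n), ∀ v ∈ Ioc 0 (Real.pi / m),
      |∑ k ∈ Finset.range n, ∑ l ∈ Finset.range m,
        φ (u + k * (Real.pi / n)) (v + l * (Real.pi / m)) *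
          (cesaroKernel (-α) n (u + k * (Real.pi / n)) *
            cesaroKernel (-β) m (v + l * (Real.pi / m)))| ≤ ε * (n * m) := by
  obtain ⟨C, hC, htail⟩ := exists_abs_sum_cesaroKernel_le (γ := -α)
    ⟨by linarith [hα.2], by linarith [hα.1]⟩
  obtain ⟨C', hC', htail'⟩ := exists_abs_sum_cesaroKernel_le (γ := -β)
    ⟨by linarith [hβ.2], by linarith [hβ.1]⟩
  simp only [neg_neg] at htail htail'
  obtain ⟨η, hη, P, hmain⟩ := exists_sum_abs_mixedDiff_grid_le hα hβ hαβ hpos hanti hsum hV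
    (ε := ε / (C * C')) (by positivity)
  refine ⟨η, hη, P, fun φ h₁ h₂ n m hn hm hsmall u hu v hv => ?_⟩
  calc _ ≤ C * n * (C' * m) * (ε / (C * C')) :=
        (abs_sum_sum_mul_le_sum_abs_mixedDiff (htail n hn u (Ioc_subset_Icc_self hu))
          (htail' m hm v (Ioc_subset_Icc_self hv)) _).trans
          (mul_le_mul_of_nonneg_left (hmain φ h₁ h₂ n m hn hm hsmall u hu v hv) (by positivity))
    _ = ε * (n * m) := by field_simp

end Grid

section Torus

/-- The lattice `Tℤ × T'ℤ` of periods of a function on the plane with periods `T` and `T'` in the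
two variables. -/
noncomputable def periodLattice (T T' : ℝ) : AddSubgroup (ℝ × ℝ) :=
  (AddSubgroup.zmultiples T).prod (AddSubgroup.zmultiples T')

variable {T T' : ℝ}

lemma mem_periodLattice {p : ℝ × ℝ} :
    p ∈ periodLattice T T' ↔ ∃ i j : ℤ, (i • T, j • T') = p := by
  simp only [periodLattice, AddSubgroup.mem_prod, AddSubgroup.mem_zmultiples_iff, Prod.ext_iff,
    exists_and_left, exists_and_right]

instance : Countable (periodLattice T T') := by
  have hcount (S : ℝ) : (AddSubgroup.zmultiples S : Set ℝ).Countable := by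
    rw [AddSubgroup.coe_zmultiples]
    exact countable_range _
  exact (hcount T).prod (hcount T')

lemma isAddFundamentalDomain_prod_Ioc (hT : 0 < T) (hT' : 0 < T') (x y : ℝ) :
    IsAddFundamentalDomain (periodLattice T T') (Ioc x (x + T) ×ˢ Ioc y (y + T'))
      (volume : Measure (ℝ × ℝ)) := by
  refine IsAddFundamentalDomain.mk' (measurableSet_Ioc.prod measurableSet_Ioc).nullMeasurableSet ?_
  rintro ⟨p, q⟩
  obtain ⟨i, hi, hi'⟩ := existsUnique_add_zsmul_mem_Ioc hT p x
  obtain ⟨j, hj, hj'⟩ := existsUnique_add_zsmul_mem_Ioc hT' q y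
  refine ⟨⟨(i • T, j • T'), mem_periodLattice.2 ⟨i, j, rfl⟩⟩, ⟨?_, ?_⟩, ?_⟩
  · simpa [AddSubgroup.vadd_def, add_comm] using hi
  · simpa [AddSubgroup.vadd_def, add_comm] using hj
  · rintro ⟨g, hg⟩ ⟨h, h'⟩
    obtain ⟨i', j', rfl⟩ := mem_periodLattice.1 hg
    obtain rfl := hi' i' (by simpa [AddSubgroup.vadd_def, add_comm] using h)
    obtain rfl := hj' j' (by simpa [AddSubgroup.vadd_def, add_comm] using h')
    rfl

variable {E : Type*} {G : ℝ × ℝ → E}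

lemma periodLattice_vadd_eq (h : ∀ x y, G (x + T, y) = G (x, y))
    (h' : ∀ x y, G (x, y + T') = G (x, y)) (g : periodLattice T T') (p : ℝ × ℝ) :
    G (g +ᵥ p) = G p := by
  obtain ⟨g, hg⟩ := g
  obtain ⟨s, t⟩ := p
  obtain ⟨i, j, rfl⟩ := mem_periodLattice.1 hg
  have e : Function.Periodic (fun s => G (s, t + j • T')) T := fun s => h s _
  have e' : Function.Periodic (fun t => G (s, t)) T' := h' s
  simpa [AddSubgroup.vadd_def, add_comm] using (e.zsmul i s).trans (e'.zsmul j t)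

variable [NormedAddCommGroup E]

lemma integrableOn_prod_Ioc_of_periodic (hT : 0 < T) (hT' : 0 < T')
    (h : ∀ x y, G (x + T, y) = G (x, y)) (h' : ∀ x y, G (x, y + T') = G (x, y))
    (hG : IntegrableOn G (Icc 0 T ×ˢ Icc 0 T')) (x y : ℝ) :
    IntegrableOn G (Ioc x (x + T) ×ˢ Ioc y (y + T')) := by
  refine ((isAddFundamentalDomain_prod_Ioc hT hT' 0 0).integrableOn_iff
    (isAddFundamentalDomain_prod_Ioc hT hT' x y) (periodLattice_vadd_eq h h')).1 (hG.mono_set ?_)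
  rw [zero_add, zero_add]
  exact prod_mono Ioc_subset_Icc_self Ioc_subset_Icc_self

lemma setIntegral_prod_Icc_eq_of_periodic [NormedSpace ℝ E] (hT : 0 < T) (hT' : 0 < T')
    (h : ∀ x y, G (x + T, y) = G (x, y)) (h' : ∀ x y, G (x, y + T') = G (x, y)) (x y : ℝ) :
    ∫ p in Icc 0 T ×ˢ Icc 0 T', G p = ∫ p in Ioc x (x + T) ×ˢ Ioc y (y + T'), G p := by
  rw [← (isAddFundamentalDomain_prod_Ioc hT hT' 0 0).setIntegral_eq
    (isAddFundamentalDomain_prod_Ioc hT hT' x y) (periodLattice_vadd_eq h h'), zero_add, zero_add]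
  exact setIntegral_congr_set (Measure.set_prod_ae_eq Ioc_ae_eq_Icc Ioc_ae_eq_Icc).symm

end Torus

section Cells

variable {E : Type*} [NormedAddCommGroup E] {G : ℝ × ℝ → E}
  {I J : Type*} {s : Finset I} {t : Finset J} {S : I → ℝ → ℝ} {T : J → ℝ → ℝ}
  {μ μ₀ ν ν₀ : Measure ℝ} [SFinite μ₀] [SFinite ν₀]

lemma prod_eq_sum_map_prod (hS : ∀ i, Measurable (S i)) (hT : ∀ j, Measurable (T j))
    (hμ : μ = ∑ i ∈ s, μ₀.map (S i)) (hν : ν = ∑ j ∈ t, ν₀.map (T j)) :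
    μ.prod ν = ∑ q ∈ s ×ˢ t, (μ₀.prod ν₀).map (Prod.map (S q.1) (T q.2)) := by
  rw [hμ, hν, ← Measure.sum_coe_finset, ← Measure.sum_coe_finset, Measure.prod_sum,
    Measure.sum_fintype, Fintype.sum_prod_type, Finset.sum_product]
  simp only [Measure.map_prod_map _ _ (hS _) (hT _)]
  rw [← Finset.sum_coe_sort s]
  exact Finset.sum_congr rfl fun i _ => Finset.sum_coe_sort t fun j =>
    (μ₀.prod ν₀).map (Prod.map (S i) (T j))

lemma integrable_comp_of_eq_sum_map (hS : ∀ i, Measurable (S i)) (hT : ∀ j, Measurable (T j))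
    (hμ : μ = ∑ i ∈ s, μ₀.map (S i)) (hν : ν = ∑ j ∈ t, ν₀.map (T j))
    (hG : Integrable G (μ.prod ν)) {i : I} (hi : i ∈ s) {j : J} (hj : j ∈ t) :
    Integrable (fun p => G (S i p.1, T j p.2)) (μ₀.prod ν₀) := by
  rw [prod_eq_sum_map_prod hS hT hμ hν] at hG
  exact (integrable_finsetSum_measure.1 hG (i, j) (Finset.mk_mem_product hi hj)).comp_measurable
    ((hS i).prodMap (hT j))

lemma integral_prod_eq_sum_integral_comp [NormedSpace ℝ E] (hS : ∀ i, Measurable (S i))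
    (hT : ∀ j, Measurable (T j)) (hμ : μ = ∑ i ∈ s, μ₀.map (S i))
    (hν : ν = ∑ j ∈ t, ν₀.map (T j)) (hG : Integrable G (μ.prod ν)) :
    ∫ p, G p ∂(μ.prod ν) = ∑ i ∈ s, ∑ j ∈ t, ∫ p, G (S i p.1, T j p.2) ∂(μ₀.prod ν₀) := by
  rw [prod_eq_sum_map_prod hS hT hμ hν] at hG ⊢
  have hG' := integrable_finsetSum_measure.1 hG
  rw [integral_finsetSum_measure hG', ← Finset.sum_product']
  exact Finset.sum_congr rfl fun q hq =>
    integral_map ((hS _).prodMap (hT _)).aemeasurable (hG' q hq).aestronglyMeasurable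

end Cells

section Intervals

lemma map_add_restrict_Ioc (c h : ℝ) :
    (volume.restrict (Ioc 0 h)).map (fun u => u + c) = volume.restrict (Ioc c (c + h)) := by
  have hmp := (measurePreserving_add_right volume c).restrict_preimage
    (measurableSet_Ioc (a := c) (b := c + h))
  rw [preimage_add_const_Ioc, sub_self, add_sub_cancel_left] at hmp
  exact hmp.map_eq

lemma restrict_Ioc_mul_eq_sum {h : ℝ} (hh : 0 ≤ h) (n : ℕ) :
    volume.restrict (Ioc 0 (n * h)) =
      ∑ k ∈ Finset.range n, (volume.restrict (Ioc 0 h)).map fun u => u + k * h := by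
  induction n with
  | zero => simp
  | succ n ih =>
    rw [Finset.sum_range_succ, ← ih, map_add_restrict_Ioc,
      ← Measure.restrict_union (Ioc_disjoint_Ioc_of_le le_rfl) measurableSet_Ioc,
      Ioc_union_Ioc_eq_Ioc (by positivity) (by linarith), Nat.cast_succ, add_one_mul]

lemma restrict_Ioc_symm_eq_sum (x : ℝ) {r : ℝ} (hr : 0 ≤ r) :
    volume.restrict (Ioc (x - r) (x + r)) =
      ∑ σ : ℤˣ, (volume.restrict (Ioc 0 r)).map fun s => x + σ • s := by
  have hright : (volume.restrict (Ioc 0 r)).map (fun s => x + s) =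
      volume.restrict (Ioc x (x + r)) := by
    simpa only [add_comm x] using map_add_restrict_Ioc x r
  have hleft : (volume.restrict (Ioc 0 r)).map (fun s => x - s) =
      volume.restrict (Ioc (x - r) x) := by
    have hmp := (Measure.measurePreserving_sub_left (volume : Measure ℝ) x).restrict_preimage
      (measurableSet_Ioc (a := x - r) (b := x))
    rw [preimage_const_sub_Ioc, sub_self, sub_sub_cancel,
      Measure.restrict_congr_set Ico_ae_eq_Ioc] at hmp
    exact hmp.map_eq
  rw [UnitsInt.univ, Finset.sum_pair (by decide)]
  simp only [one_smul, Units.neg_smul, ← sub_eq_add_neg]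
  rw [hright, hleft, add_comm (volume.restrict _),
    ← Measure.restrict_union (Ioc_disjoint_Ioc_of_le le_rfl) measurableSet_Ioc,
    Ioc_union_Ioc_eq_Ioc (by linarith) (by linarith)]

lemma norm_setIntegral_le_of_norm_sum_le {E : Type*} [NormedAddCommGroup E] [NormedSpace ℝ E]
    {G : ℝ × ℝ → E} {n m : ℕ} {h h' C : ℝ} (hh : 0 ≤ h) (hh' : 0 ≤ h')
    (hG : IntegrableOn G (Ioc 0 (n * h) ×ˢ Ioc 0 (m * h')))
    (hC : ∀ u ∈ Ioc 0 h, ∀ v ∈ Ioc 0 h',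
      ‖∑ k ∈ Finset.range n, ∑ l ∈ Finset.range m, G (u + k * h, v + l * h')‖ ≤ C) :
    ‖∫ p in Ioc 0 (n * h) ×ˢ Ioc 0 (m * h'), G p‖ ≤ C * (h * h') := by
  rw [IntegrableOn, Measure.volume_eq_prod, ← Measure.prod_restrict] at hG
  have hmeas (c : ℝ) : Measurable fun u => u + c := measurable_add_const c
  have hint {k l : ℕ} (hk : k ∈ Finset.range n) (hl : l ∈ Finset.range m) :=
    integrable_comp_of_eq_sum_map (fun k : ℕ => hmeas (k * h)) (fun l : ℕ => hmeas (l * h'))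
      (restrict_Ioc_mul_eq_sum hh n) (restrict_Ioc_mul_eq_sum hh' m) hG hk hl
  have hsum : ∫ p in Ioc 0 (n * h) ×ˢ Ioc 0 (m * h'), G p =
      ∫ p in Ioc 0 h ×ˢ Ioc 0 h', ∑ k ∈ Finset.range n, ∑ l ∈ Finset.range m,
        G (p.1 + k * h, p.2 + l * h') := by
    rw [Measure.volume_eq_prod, ← Measure.prod_restrict, ← Measure.prod_restrict,
      integral_prod_eq_sum_integral_comp (fun k : ℕ => hmeas (k * h))
        (fun l : ℕ => hmeas (l * h')) (restrict_Ioc_mul_eq_sum hh n)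
        (restrict_Ioc_mul_eq_sum hh' m) hG,
      integral_finsetSum _ fun k hk => integrable_finsetSum _ fun l hl => hint hk hl]
    exact Finset.sum_congr rfl fun k hk => (integral_finsetSum _ fun l hl => hint hk hl).symm
  have hvol : volume.real (Ioc 0 h ×ˢ Ioc 0 h') = h * h' := by
    rw [Measure.volume_eq_prod, measureReal_prod_prod, Real.volume_real_Ioc_of_le hh,
      Real.volume_real_Ioc_of_le hh', sub_zero, sub_zero]
  rw [hsum, ← hvol]
  refine norm_setIntegral_le_of_norm_le_const ?_ fun p hp => hC p.1 hp.1 p.2 hp.2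
  rw [Measure.volume_eq_prod, Measure.prod_prod]
  exact ENNReal.mul_lt_top measure_Ioc_lt_top measure_Ioc_lt_top

end Intervals

section KernelIntegral

variable (γ : ℝ) (n : ℕ)

lemma continuous_dirichletKernel (i : ℕ) : Continuous (dirichletKernel i) := by
  unfold dirichletKernel
  fun_prop

lemma continuous_cesaroKernel : Continuous (cesaroKernel γ n) := by
  have := continuous_dirichletKernel
  unfold cesaroKernel
  fun_prop

lemma cesaroKernel_neg (s : ℝ) : cesaroKernel γ n (-s) = cesaroKernel γ n s := by
  simp only [cesaroKernel, dirichletKernel, mul_neg, Real.cos_neg]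

lemma cesaroKernel_sub_add_units_smul (x s : ℝ) (σ : ℤˣ) :
    cesaroKernel γ n (x - (x + σ • s)) = cesaroKernel γ n s := by
  rw [sub_add_cancel_left, cesaroKernel_neg]
  rcases Int.units_eq_one_or σ with rfl | rfl <;>
    simp only [one_smul, Units.neg_smul, cesaroKernel_neg]

lemma cesaroKernel_sub_add_two_pi (x s : ℝ) :
    cesaroKernel γ n (x - (s + 2 * Real.pi)) = cesaroKernel γ n (x - s) := by
  simp only [cesaroKernel, dirichletKernel, ← sub_sub, mul_sub, Real.cos_sub_nat_mul_two_pi]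

lemma integral_cos_nat_mul (k : ℕ) :
    ∫ s in 0..Real.pi, Real.cos (k * s) = if k = 0 then Real.pi else 0 := by
  split_ifs with hk
  · simp [hk]
  · rw [intervalIntegral.integral_comp_mul_left _ (by exact_mod_cast hk), integral_cos]
    simp [Real.sin_nat_mul_pi]

lemma integral_dirichletKernel (i : ℕ) : ∫ s in 0..Real.pi, dirichletKernel i s = Real.pi := by
  unfold dirichletKernel
  rw [intervalIntegral.integral_sub (Continuous.intervalIntegrable (by fun_prop) _ _)
      (Continuous.intervalIntegrable (by fun_prop) _ _), intervalIntegral.integral_const_mul,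
    intervalIntegral.integral_finsetSum fun k _ =>
      Continuous.intervalIntegrable (by fun_prop) _ _]
  simp only [integral_cos_nat_mul, Finset.sum_ite_eq', Finset.mem_range, Nat.succ_pos, if_true,
    intervalIntegral.integral_const, sub_zero, smul_eq_mul, mul_one]
  ring

lemma setIntegral_cesaroKernel {γ : ℝ} (hγ : -1 < γ) (n : ℕ) :
    ∫ s in Ioc 0 Real.pi, cesaroKernel γ n s = Real.pi := by
  have hsum : ∑ i ∈ Finset.range (n + 1), cesaroNumber (γ - 1) (n - i) = cesaroNumber γ n := by
    simpa [sum_range_cesaroNumber_sub_one] using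
      Finset.sum_range_reflect (cesaroNumber (γ - 1)) (n + 1)
  rw [← intervalIntegral.integral_of_le Real.pi_pos.le]
  unfold cesaroKernel
  rw [intervalIntegral.integral_div, intervalIntegral.integral_finsetSum fun i _ =>
    ((continuous_dirichletKernel i).const_mul _).intervalIntegrable _ _]
  simp only [intervalIntegral.integral_const_mul, integral_dirichletKernel]
  rw [← Finset.sum_mul, hsum, mul_div_cancel_left₀ _ (cesaroNumber_pos hγ n).ne']

lemma integrableOn_cesaroKernel_mul_cesaroKernel (γ δ : ℝ) (n m : ℕ) (a b : ℝ) :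
    IntegrableOn (fun p : ℝ × ℝ => cesaroKernel γ n p.1 * cesaroKernel δ m p.2)
      (Ioc 0 a ×ˢ Ioc 0 b) := by
  have := continuous_cesaroKernel γ n
  have := continuous_cesaroKernel δ m
  exact (ContinuousOn.integrableOn_compact (isCompact_Icc.prod isCompact_Icc)
    (by fun_prop)).mono_set (prod_mono Ioc_subset_Icc_self Ioc_subset_Icc_self)

lemma setIntegral_cesaroKernel_mul_cesaroKernel {γ δ : ℝ} (hγ : -1 < γ) (hδ : -1 < δ) (n m : ℕ) :
    ∫ p in Ioc 0 Real.pi ×ˢ Ioc 0 Real.pi, cesaroKernel γ n p.1 * cesaroKernel δ m p.2 =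
      Real.pi ^ 2 := by
  rw [Measure.volume_eq_prod, setIntegral_prod_mul, setIntegral_cesaroKernel hγ,
    setIntegral_cesaroKernel hδ, sq]

end KernelIntegral

section Means

variable {f : ℝ × ℝ → ℝ}

lemma isCompact_square : IsCompact square := isCompact_Icc.prod isCompact_Icc

lemma integrableOn_square_mul_of_continuous (hf : IntegrableOn f square) {φ : ℝ × ℝ → ℝ}
    (hφ : Continuous φ) : IntegrableOn (fun p => f p * φ p) square :=
  hf.mul_continuousOn hφ.continuousOn isCompact_square

lemma integral_sum_sum_mul {α ι κ 𝕜 : Type*} [MeasurableSpace α] [RCLike 𝕜] {μ : Measure α}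
    (s : Finset ι) (t : Finset κ) (c : ι → κ → 𝕜) {G : ι → κ → α → 𝕜}
    (hG : ∀ i j, Integrable (G i j) μ) :
    ∫ p, ∑ i ∈ s, ∑ j ∈ t, c i j * G i j p ∂μ = ∑ i ∈ s, ∑ j ∈ t, c i j * ∫ p, G i j p ∂μ := by
  rw [integral_finsetSum _ fun i _ => integrable_finsetSum _ fun j _ => (hG i j).const_mul _]
  refine Finset.sum_congr rfl fun i _ => ?_
  rw [integral_finsetSum _ fun j _ => (hG i j).const_mul _]
  exact Finset.sum_congr rfl fun j _ => integral_const_mul _ _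

lemma partialSum_eq_integral_dirichletKernel (hf : IntegrableOn f square) (M N : ℕ) (x y : ℝ) :
    partialSum f M N (x, y) = ((1 / (4 * Real.pi ^ 2) * ∫ p in square, f p *
      (dirichletKernel M (x - p.1) * dirichletKernel N (y - p.2)) : ℝ) : ℂ) := by
  have hexp (k l : ℤ) (p : ℝ × ℝ) :
      Complex.exp (-(Complex.I * k * p.1)) * Complex.exp (-(Complex.I * l * p.2)) *
        (Complex.exp (Complex.I * k * x) * Complex.exp (Complex.I * l * y)) =
      Complex.exp (Complex.I * k * (x - p.1 : ℝ)) *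
        Complex.exp (Complex.I * l * (y - p.2 : ℝ)) := by
    simp only [← Complex.exp_add]
    push_cast
    ring_nf
  have hint (k l : ℤ) : IntegrableOn (fun p : ℝ × ℝ => (f p : ℂ) *
      (Complex.exp (-(Complex.I * k * p.1)) * Complex.exp (-(Complex.I * l * p.2)))) square :=
    IntegrableOn.mul_continuousOn (Integrable.ofReal hf) (by fun_prop) isCompact_square
  calc partialSum f M N (x, y)
      = 1 / (4 * (Real.pi : ℂ) ^ 2) * ∑ k ∈ Finset.Icc (-(M : ℤ)) M, ∑ l ∈ Finset.Icc (-(N : ℤ)) N,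
          (Complex.exp (Complex.I * k * x) * Complex.exp (Complex.I * l * y)) *
          ∫ p in square, (f p : ℂ) *
            (Complex.exp (-(Complex.I * k * p.1)) * Complex.exp (-(Complex.I * l * p.2))) := by
        simp only [partialSum, coeff, Finset.mul_sum, mul_assoc, mul_comm, mul_left_comm]
    _ = 1 / (4 * (Real.pi : ℂ) ^ 2) * ∫ p in square, ((f p *
          (dirichletKernel M (x - p.1) * dirichletKernel N (y - p.2)) : ℝ) : ℂ) := by
        rw [← integral_sum_sum_mul _ _ _ hint]
        congr 2 with p
        push_cast
        rw [← sum_Icc_exp_eq_dirichletKernel, ← sum_Icc_exp_eq_dirichletKernel, Finset.sum_mul_sum]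
        simp only [Finset.mul_sum (Finset.Icc _ _), ← hexp]
        refine Finset.sum_congr rfl fun k _ => Finset.sum_congr rfl fun l _ => ?_
        ring
    _ = _ := by
        rw [integral_complex_ofReal]
        push_cast
        rfl

lemma cesaroMean_eq_integral_cesaroKernel (hf : IntegrableOn f square) (γ δ : ℝ) (n m : ℕ)
    (x y : ℝ) :
    cesaroMean γ δ f n m (x, y) = ((1 / (4 * Real.pi ^ 2) * ∫ p in square, f p *
      (cesaroKernel γ n (x - p.1) * cesaroKernel δ m (y - p.2)) : ℝ) : ℂ) := by
  have hint (i j : ℕ) : IntegrableOn (fun p : ℝ × ℝ => f p *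
      (dirichletKernel i (x - p.1) * dirichletKernel j (y - p.2))) square := by
    have := continuous_dirichletKernel
    exact integrableOn_square_mul_of_continuous hf (by fun_prop)
  have hkernel (p : ℝ × ℝ) :
      f p * (cesaroKernel γ n (x - p.1) * cesaroKernel δ m (y - p.2)) =
      1 / cesaroNumber γ n * (1 / cesaroNumber δ m) *
      ∑ i ∈ Finset.range (n + 1), ∑ j ∈ Finset.range (m + 1),
        cesaroNumber (γ - 1) (n - i) * cesaroNumber (δ - 1) (m - j) *
          (f p * (dirichletKernel i (x - p.1) * dirichletKernel j (y - p.2))) := by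
    rw [cesaroKernel, cesaroKernel, div_mul_div_comm, Finset.sum_mul_sum, mul_div_assoc',
      div_mul_div_comm, one_mul, one_div_mul_eq_div]
    simp only [Finset.mul_sum]
    congr! 3
    ring
  simp only [hkernel]
  rw [integral_const_mul, integral_sum_sum_mul _ _ _ hint]
  simp only [cesaroMean, partialSum_eq_integral_dirichletKernel hf, Finset.mul_sum]
  push_cast
  simp only [mul_left_comm]

end Means

section Quadrants

variable {E : Type*} [NormedAddCommGroup E] {G : ℝ × ℝ → E} {r : ℝ}

lemma integrable_prod_restrict_Ioc_symm (hr : 0 < r) (h : ∀ x y, G (x + 2 * r, y) = G (x, y))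
    (h' : ∀ x y, G (x, y + 2 * r) = G (x, y))
    (hG : IntegrableOn G (Icc 0 (2 * r) ×ˢ Icc 0 (2 * r))) (x y : ℝ) :
    Integrable G ((volume.restrict (Ioc (x - r) (x + r))).prod
      (volume.restrict (Ioc (y - r) (y + r)))) := by
  have hend (c : ℝ) : c - r + 2 * r = c + r := by ring
  have := integrableOn_prod_Ioc_of_periodic (by positivity) (by positivity) h h' hG (x - r) (y - r)
  rwa [hend, hend, IntegrableOn, Measure.volume_eq_prod, ← Measure.prod_restrict] at this

lemma integrableOn_quadrant_of_periodic (hr : 0 < r) (h : ∀ x y, G (x + 2 * r, y) = G (x, y))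
    (h' : ∀ x y, G (x, y + 2 * r) = G (x, y))
    (hG : IntegrableOn G (Icc 0 (2 * r) ×ˢ Icc 0 (2 * r))) (x y : ℝ) (σ τ : ℤˣ) :
    IntegrableOn (fun p => G (x + σ • p.1, y + τ • p.2)) (Ioc 0 r ×ˢ Ioc 0 r) := by
  rw [IntegrableOn, Measure.volume_eq_prod, ← Measure.prod_restrict]
  exact integrable_comp_of_eq_sum_map (fun _ => by fun_prop) (fun _ => by fun_prop)
    (restrict_Ioc_symm_eq_sum x hr.le) (restrict_Ioc_symm_eq_sum y hr.le)
    (integrable_prod_restrict_Ioc_symm hr h h' hG x y) (Finset.mem_univ σ) (Finset.mem_univ τ)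

lemma setIntegral_eq_sum_quadrants_of_periodic [NormedSpace ℝ E] (hr : 0 < r)
    (h : ∀ x y, G (x + 2 * r, y) = G (x, y)) (h' : ∀ x y, G (x, y + 2 * r) = G (x, y))
    (hG : IntegrableOn G (Icc 0 (2 * r) ×ˢ Icc 0 (2 * r))) (x y : ℝ) :
    ∫ p in Icc 0 (2 * r) ×ˢ Icc 0 (2 * r), G p =
      ∑ σ : ℤˣ, ∑ τ : ℤˣ, ∫ p in Ioc 0 r ×ˢ Ioc 0 r, G (x + σ • p.1, y + τ • p.2) := by
  have hend (c : ℝ) : c - r + 2 * r = c + r := by ring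
  rw [setIntegral_prod_Icc_eq_of_periodic (by positivity) (by positivity) h h' (x - r) (y - r),
    hend, hend, Measure.volume_eq_prod, ← Measure.prod_restrict, ← Measure.prod_restrict]
  exact integral_prod_eq_sum_integral_comp (fun _ => by fun_prop) (fun _ => by fun_prop)
    (restrict_Ioc_symm_eq_sum x hr.le) (restrict_Ioc_symm_eq_sum y hr.le)
    (integrable_prod_restrict_Ioc_symm hr h h' hG x y)

end Quadrants

section Deviation

/-- The difference between `f` and a number `L σ τ` on the open coordinate quadrant with vertex
`(x, y)` selected by the signs `σ` and `τ`, in coordinates in which the quadrant is `s, t > 0`. -/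
def quadrantDeviation (f : ℝ × ℝ → ℝ) (L : ℤˣ → ℤˣ → ℝ) (x y : ℝ) (σ τ : ℤˣ) (s t : ℝ) : ℝ :=
  f (x + σ • s, y + τ • t) - L σ τ

variable {f : ℝ × ℝ → ℝ}

lemma variationLE_quadrantDeviation {lam : ℕ → ℝ} {V : ℝ}
    (hf : ∀ y, VariationLE lam V fun x => f (x, y)) (L : ℤˣ → ℤˣ → ℝ) (x y : ℝ) (σ τ : ℤˣ)
    (t : ℝ) : VariationLE lam V fun s => quadrantDeviation f L x y σ τ s t :=
  ((hf (y + τ • t)).comp_add_smul x σ).sub_const (L σ τ)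

lemma variationLE_quadrantDeviation_right {lam : ℕ → ℝ} {V : ℝ}
    (hf : ∀ x, VariationLE lam V fun y => f (x, y)) (L : ℤˣ → ℤˣ → ℝ) (x y : ℝ) (σ τ : ℤˣ)
    (s : ℝ) : VariationLE lam V (quadrantDeviation f L x y σ τ s) :=
  ((hf (x + σ • s)).comp_add_smul y τ).sub_const (L σ τ)

lemma integrableOn_quadrant_mul_cesaroKernel (hper : Periodic2 f) (hf : IntegrableOn f square)
    (γ γ' : ℝ) (n m : ℕ) (x y : ℝ) (σ τ : ℤˣ) :
    IntegrableOn (fun p : ℝ × ℝ => f (x + σ • p.1, y + τ • p.2) *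
      (cesaroKernel γ n p.1 * cesaroKernel γ' m p.2)) (Ioc 0 Real.pi ×ˢ Ioc 0 Real.pi) := by
  have := continuous_cesaroKernel
  simpa only [cesaroKernel_sub_add_units_smul] using
    integrableOn_quadrant_of_periodic Real.pi_pos
      (G := fun p => f p * (cesaroKernel γ n (x - p.1) * cesaroKernel γ' m (y - p.2)))
      (fun s t => by simp only [hper.1, cesaroKernel_sub_add_two_pi])
      (fun s t => by simp only [hper.2, cesaroKernel_sub_add_two_pi])
      (integrableOn_square_mul_of_continuous hf (by fun_prop)) x y σ τ

lemma setIntegral_square_mul_cesaroKernel_eq (hper : Periodic2 f) (hf : IntegrableOn f square)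
    (γ γ' : ℝ) (n m : ℕ) (x y : ℝ) :
    ∫ p in square, f p * (cesaroKernel γ n (x - p.1) * cesaroKernel γ' m (y - p.2)) =
      ∑ σ : ℤˣ, ∑ τ : ℤˣ, ∫ p in Ioc 0 Real.pi ×ˢ Ioc 0 Real.pi,
        f (x + σ • p.1, y + τ • p.2) * (cesaroKernel γ n p.1 * cesaroKernel γ' m p.2) := by
  have := continuous_cesaroKernel
  simpa only [square, cesaroKernel_sub_add_units_smul] using
    setIntegral_eq_sum_quadrants_of_periodic Real.pi_pos
      (G := fun p => f p * (cesaroKernel γ n (x - p.1) * cesaroKernel γ' m (y - p.2)))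
      (fun s t => by simp only [hper.1, cesaroKernel_sub_add_two_pi])
      (fun s t => by simp only [hper.2, cesaroKernel_sub_add_two_pi])
      (integrableOn_square_mul_of_continuous hf (by fun_prop)) x y

lemma integrableOn_quadrantDeviation_mul_cesaroKernel (hper : Periodic2 f)
    (hf : IntegrableOn f square) (γ γ' : ℝ) (n m : ℕ) (L : ℤˣ → ℤˣ → ℝ) (x y : ℝ) (σ τ : ℤˣ) :
    IntegrableOn (fun p : ℝ × ℝ => quadrantDeviation f L x y σ τ p.1 p.2 *
      (cesaroKernel γ n p.1 * cesaroKernel γ' m p.2)) (Ioc 0 Real.pi ×ˢ Ioc 0 Real.pi) := by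
  simp only [quadrantDeviation, sub_mul]
  exact (integrableOn_quadrant_mul_cesaroKernel hper hf γ γ' n m x y σ τ).sub
    ((integrableOn_cesaroKernel_mul_cesaroKernel γ γ' n m _ _).const_mul _)

lemma setIntegral_quadrantDeviation_mul_cesaroKernel (hper : Periodic2 f)
    (hf : IntegrableOn f square) {γ γ' : ℝ} (hγ : -1 < γ) (hγ' : -1 < γ') (n m : ℕ)
    (L : ℤˣ → ℤˣ → ℝ) (x y : ℝ) (σ τ : ℤˣ) :
    ∫ p in Ioc 0 Real.pi ×ˢ Ioc 0 Real.pi, quadrantDeviation f L x y σ τ p.1 p.2 *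
        (cesaroKernel γ n p.1 * cesaroKernel γ' m p.2) =
      (∫ p in Ioc 0 Real.pi ×ˢ Ioc 0 Real.pi, f (x + σ • p.1, y + τ • p.2) *
        (cesaroKernel γ n p.1 * cesaroKernel γ' m p.2)) - L σ τ * Real.pi ^ 2 := by
  simp only [quadrantDeviation, sub_mul]
  rw [integral_sub (integrableOn_quadrant_mul_cesaroKernel hper hf γ γ' n m x y σ τ)
      ((integrableOn_cesaroKernel_mul_cesaroKernel γ γ' n m _ _).const_mul _),
    integral_const_mul, setIntegral_cesaroKernel_mul_cesaroKernel hγ hγ']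

lemma cesaroMean_sub_eq_sum_quadrantDeviation (hper : Periodic2 f) (hf : IntegrableOn f square)
    {γ γ' : ℝ} (hγ : -1 < γ) (hγ' : -1 < γ') (n m : ℕ) (L : ℤˣ → ℤˣ → ℝ) (x y : ℝ) :
    cesaroMean γ γ' f n m (x, y) - (((∑ σ, ∑ τ, L σ τ) / 4 : ℝ) : ℂ) =
      ((1 / (4 * Real.pi ^ 2) * ∑ σ : ℤˣ, ∑ τ : ℤˣ, ∫ p in Ioc 0 Real.pi ×ˢ Ioc 0 Real.pi,
        quadrantDeviation f L x y σ τ p.1 p.2 *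
          (cesaroKernel γ n p.1 * cesaroKernel γ' m p.2) : ℝ) : ℂ) := by
  rw [cesaroMean_eq_integral_cesaroKernel hf, ← Complex.ofReal_sub,
    setIntegral_square_mul_cesaroKernel_eq hper hf]
  simp only [setIntegral_quadrantDeviation_mul_cesaroKernel hper hf hγ hγ',
    Finset.sum_sub_distrib, ← Finset.sum_mul]
  field_simp

end Deviation

section Convergence

variable {f : ℝ × ℝ → ℝ} {lam : ℕ → ℝ} {α β V ε : ℝ}

lemma exists_abs_setIntegral_mul_cesaroKernel_le (hα : α ∈ Ioo (0 : ℝ) 1) (hβ : β ∈ Ioo (0 : ℝ) 1)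
    (hαβ : α + β < 1) (hpos : ∀ k, 1 ≤ k → 0 < lam k)
    (hanti : AntitoneOn (fun k : ℕ => lam k / (k : ℝ) ^ (1 - (α + β))) (Ici 1))
    (hsum : Summable fun k : ℕ => lam (k + 1) / ((k + 1 : ℕ) : ℝ) ^ (2 - (α + β)))
    (hV : 0 ≤ V) (hε : 0 < ε) :
    ∃ η > 0, ∃ P : ℕ, ∀ φ : ℝ → ℝ → ℝ, (∀ t, VariationLE lam V fun s => φ s t) →
      (∀ s, VariationLE lam V (φ s)) → ∀ n m : ℕ, 1 ≤ n → 1 ≤ m →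
      IntegrableOn (fun p : ℝ × ℝ => φ p.1 p.2 *
        (cesaroKernel (-α) n p.1 * cesaroKernel (-β) m p.2)) (Ioc 0 Real.pi ×ˢ Ioc 0 Real.pi) →
      (∀ s ∈ Ioc 0 (P * (Real.pi / n)), ∀ t ∈ Ioc 0 (P * (Real.pi / m)), |φ s t| ≤ η) →
      |∫ p in Ioc 0 Real.pi ×ˢ Ioc 0 Real.pi, φ p.1 p.2 *
        (cesaroKernel (-α) n p.1 * cesaroKernel (-β) m p.2)| ≤ ε * Real.pi ^ 2 := by
  obtain ⟨η, hη, P, hmain⟩ :=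
    exists_abs_sum_grid_mul_cesaroKernel_le hα hβ hαβ hpos hanti hsum hV hε
  refine ⟨η, hη, P, fun φ h₁ h₂ n m hn hm hint hsmall => ?_⟩
  have hn0 : (n : ℝ) ≠ 0 := by positivity
  have hm0 : (m : ℝ) ≠ 0 := by positivity
  have hbound := norm_setIntegral_le_of_norm_sum_le (n := n) (m := m) (h := Real.pi / n)
    (h' := Real.pi / m) (C := ε * (n * m)) (by positivity) (by positivity)
    (by rwa [mul_div_cancel₀ _ hn0, mul_div_cancel₀ _ hm0])
    (hmain φ h₁ h₂ n m hn hm hsmall)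
  rw [mul_div_cancel₀ _ hn0, mul_div_cancel₀ _ hm0] at hbound
  refine hbound.trans_eq ?_
  field_simp

lemma exists_norm_cesaroMean_sub_le (hα : α ∈ Ioo (0 : ℝ) 1) (hβ : β ∈ Ioo (0 : ℝ) 1)
    (hαβ : α + β < 1) (hpos : ∀ k, 1 ≤ k → 0 < lam k)
    (hanti : AntitoneOn (fun k : ℕ => lam k / (k : ℝ) ^ (1 - (α + β))) (Ici 1))
    (hsum : Summable fun k : ℕ => lam (k + 1) / ((k + 1 : ℕ) : ℝ) ^ (2 - (α + β)))
    (hper : Periodic2 f) (hint : IntegrableOn f square) (hf : BoundedPartialVar lam f)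
    (hε : 0 < ε) :
    ∃ η > 0, ∃ P : ℕ, ∀ n m : ℕ, 1 ≤ n → 1 ≤ m → ∀ (x y : ℝ) (L : ℤˣ → ℤˣ → ℝ),
      (∀ σ τ, ∀ s ∈ Ioc 0 (P * (Real.pi / n)), ∀ t ∈ Ioc 0 (P * (Real.pi / m)),
        |quadrantDeviation f L x y σ τ s t| ≤ η) →
      ‖cesaroMean (-α) (-β) f n m (x, y) - (((∑ σ, ∑ τ, L σ τ) / 4 : ℝ) : ℂ)‖ ≤ ε := by
  obtain ⟨V, hV, hV₁, hV₂⟩ := exists_forall_variationLE hpos hper hf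
  obtain ⟨η, hη, P, hmain⟩ :=
    exists_abs_setIntegral_mul_cesaroKernel_le hα hβ hαβ hpos hanti hsum hV hε
  refine ⟨η, hη, P, fun n m hn hm x y L hL => ?_⟩
  rw [cesaroMean_sub_eq_sum_quadrantDeviation hper hint (by linarith [hα.2]) (by linarith [hβ.2]),
    Complex.norm_real, Real.norm_eq_abs, abs_mul, abs_of_pos (by positivity)]
  calc _ ≤ 1 / (4 * Real.pi ^ 2) * ∑ _σ : ℤˣ, ∑ _τ : ℤˣ, ε * Real.pi ^ 2 := by
        gcongr
        refine (Finset.abs_sum_le_sum_abs _ _).trans (Finset.sum_le_sum fun σ _ =>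
          (Finset.abs_sum_le_sum_abs _ _).trans (Finset.sum_le_sum fun τ _ => ?_))
        exact hmain _ (variationLE_quadrantDeviation hV₁ L x y σ τ)
          (variationLE_quadrantDeviation_right hV₂ L x y σ τ) n m hn hm
          (integrableOn_quadrantDeviation_mul_cesaroKernel hper hint _ _ n m L x y σ τ) (hL σ τ)
    _ = ε := by
        simp only [Finset.sum_const, Finset.card_univ, Fintype.card_units_int, nsmul_eq_mul]
        field_simp
        norm_num

lemma eventually_Ioc_subset (P : ℕ) {W : Set ℝ} (hW : W ∈ 𝓝[>] (0 : ℝ)) :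
    ∀ᶠ n : ℕ in atTop, Ioc 0 (P * (Real.pi / n)) ⊆ W := by
  obtain ⟨r, hr, hsub⟩ := mem_nhdsGT_iff_exists_Ioo_subset.1 hW
  have hlim : Tendsto (fun n : ℕ => P * (Real.pi / n)) atTop (𝓝 0) := by
    simpa using (tendsto_const_div_atTop_nhds_zero_nat Real.pi).const_mul (P : ℝ)
  filter_upwards [hlim.eventually (gt_mem_nhds hr)] with n hn
  exact fun s hs => hsub ⟨hs.1, hs.2.trans_lt hn⟩

lemma eventually_forall_Ioc_of_eventually {p : ℝ × ℝ → Prop} (P : ℕ)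
    (h : ∀ᶠ q in 𝓝[>] 0 ×ˢ 𝓝[>] 0, p q) :
    ∀ᶠ k : ℕ × ℕ in atTop ×ˢ atTop, ∀ s ∈ Ioc 0 (P * (Real.pi / k.1)),
      ∀ t ∈ Ioc 0 (P * (Real.pi / k.2)), p (s, t) := by
  obtain ⟨W, hW, W', hW', hsub⟩ := mem_prod_iff.1 h
  filter_upwards [(eventually_Ioc_subset P hW).prod_mk (eventually_Ioc_subset P hW')]
    with k hk s hs t ht
  exact hsub (mk_mem_prod (hk.1 hs) (hk.2 ht))

lemma eventually_one_le_and_one_le :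
    ∀ᶠ k : ℕ × ℕ in atTop ×ˢ atTop, 1 ≤ k.1 ∧ 1 ≤ k.2 :=
  (eventually_ge_atTop 1).prod_mk (eventually_ge_atTop 1)

lemma cesaroSummable_of_tendsto_quadrants (hα : α ∈ Ioo (0 : ℝ) 1) (hβ : β ∈ Ioo (0 : ℝ) 1)
    (hαβ : α + β < 1) (hpos : ∀ k, 1 ≤ k → 0 < lam k)
    (hanti : AntitoneOn (fun k : ℕ => lam k / (k : ℝ) ^ (1 - (α + β))) (Ici 1))
    (hsum : Summable fun k : ℕ => lam (k + 1) / ((k + 1 : ℕ) : ℝ) ^ (2 - (α + β)))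
    (hper : Periodic2 f) (hint : IntegrableOn f square) (hf : BoundedPartialVar lam f)
    {x y : ℝ} {L : ℤˣ → ℤˣ → ℝ}
    (hL : ∀ σ τ : ℤˣ, Tendsto (fun q : ℝ × ℝ => f (x + σ • q.1, y + τ • q.2))
      (𝓝[>] 0 ×ˢ 𝓝[>] 0) (𝓝 (L σ τ))) :
    CesaroSummable (-α) (-β) f (x, y) ((∑ σ, ∑ τ, L σ τ) / 4) := by
  refine Metric.tendsto_nhds.2 fun ε hε => ?_
  obtain ⟨η, hη, P, hmain⟩ := exists_norm_cesaroMean_sub_le hα hβ hαβ hpos hanti hsum hper hint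
    hf (half_pos hε)
  have hclose : ∀ᶠ q : ℝ × ℝ in 𝓝[>] 0 ×ˢ 𝓝[>] 0, ∀ σ τ,
      |quadrantDeviation f L x y σ τ q.1 q.2| ≤ η :=
    eventually_all.2 fun σ => eventually_all.2 fun τ => hL σ τ (Metric.closedBall_mem_nhds _ hη)
  filter_upwards [eventually_one_le_and_one_le, eventually_forall_Ioc_of_eventually P hclose]
    with k hk hsmall
  rw [dist_eq_norm]
  exact (hmain k.1 k.2 hk.1 hk.2 x y L fun σ τ s hs t ht => hsmall s hs t ht σ τ).trans_lt
    (half_lt_self hε)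

lemma dist_add_units_smul (p : ℝ × ℝ) (σ τ : ℤˣ) (s t : ℝ) :
    dist p (p.1 + σ • s, p.2 + τ • t) = max |s| |t| := by
  rcases Int.units_eq_one_or σ with rfl | rfl <;> rcases Int.units_eq_one_or τ with rfl | rfl <;>
    simp [Prod.dist_eq]

lemma cesaroSummableUniformlyOn_of_continuousAt (hα : α ∈ Ioo (0 : ℝ) 1) (hβ : β ∈ Ioo (0 : ℝ) 1)
    (hαβ : α + β < 1) (hpos : ∀ k, 1 ≤ k → 0 < lam k)
    (hanti : AntitoneOn (fun k : ℕ => lam k / (k : ℝ) ^ (1 - (α + β))) (Ici 1))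
    (hsum : Summable fun k : ℕ => lam (k + 1) / ((k + 1 : ℕ) : ℝ) ^ (2 - (α + β)))
    (hper : Periodic2 f) (hint : IntegrableOn f square) (hf : BoundedPartialVar lam f)
    {K : Set (ℝ × ℝ)} (hK : IsCompact K) (hcont : ∀ p ∈ K, ContinuousAt f p) :
    CesaroSummableUniformlyOn (-α) (-β) f K := by
  refine Metric.tendstoUniformlyOn_iff.2 fun ε hε => ?_
  obtain ⟨η, hη, P, hmain⟩ := exists_norm_cesaroMean_sub_le hα hβ hαβ hpos hanti hsum hper hint
    hf (half_pos hε)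
  obtain ⟨r, hr, hunif⟩ := Metric.mem_uniformity_dist.1
    (hK.uniformContinuousAt_of_continuousAt f hcont (Metric.dist_mem_uniformity hη))
  have hclose : ∀ᶠ q : ℝ × ℝ in 𝓝[>] 0 ×ˢ 𝓝[>] 0, ∀ p ∈ K, ∀ σ τ,
      |quadrantDeviation f (fun _ _ => f p) p.1 p.2 σ τ q.1 q.2| ≤ η := by
    filter_upwards [prod_mem_prod (Ioo_mem_nhdsGT hr) (Ioo_mem_nhdsGT hr)] with q hq p hp σ τ
    have hdist : dist p (p.1 + σ • q.1, p.2 + τ • q.2) < r := by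
      rw [dist_add_units_smul, abs_of_pos hq.1.1, abs_of_pos hq.2.1]
      exact max_lt hq.1.2 hq.2.2
    rw [quadrantDeviation, abs_sub_comm]
    exact le_of_lt (hunif hdist hp)
  filter_upwards [eventually_one_le_and_one_le, eventually_forall_Ioc_of_eventually P hclose]
    with k hk hsmall p hp
  have := hmain k.1 k.2 hk.1 hk.2 p.1 p.2 (fun _ _ => f p)
    fun σ τ s hs t ht => hsmall s hs t ht p hp σ τ
  have hmean : (∑ _σ : ℤˣ, ∑ _τ : ℤˣ, f p) / 4 = f p := by
    simp only [Finset.sum_const, Finset.card_univ, Fintype.card_units_int, nsmul_eq_mul]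
    ring
  rw [hmean] at this
  rw [dist_comm, dist_eq_norm]
  exact this.trans_lt (half_lt_self hε)

lemma tendsto_add_nhdsGT (x : ℝ) : Tendsto (fun s => x + s) (𝓝[>] 0) (𝓝[>] x) := by
  refine tendsto_nhdsWithin_iff.2 ⟨?_, ?_⟩
  · exact (Continuous.tendsto' (by fun_prop) 0 x (add_zero x)).mono_left nhdsWithin_le_nhds
  · filter_upwards [self_mem_nhdsWithin] with s hs using lt_add_of_pos_right x hs

lemma tendsto_sub_nhdsGT (x : ℝ) : Tendsto (fun s => x - s) (𝓝[>] 0) (𝓝[<] x) := by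
  refine tendsto_nhdsWithin_iff.2 ⟨?_, ?_⟩
  · exact (Continuous.tendsto' (by fun_prop) 0 x (sub_zero x)).mono_left nhdsWithin_le_nhds
  · filter_upwards [self_mem_nhdsWithin] with s hs using sub_lt_self x hs

end Convergence

end PartialVariation

open PartialVariation in
theorem theorem1 (α β : ℝ) (hα : α ∈ Ioo (0 : ℝ) 1) (hβ : β ∈ Ioo (0 : ℝ) 1)
    (hαβ : α + β < 1)
    (lam : ℕ → ℝ) (hpos : ∀ k, 1 ≤ k → 0 < lam k)
    (hanti : AntitoneOn (fun k : ℕ => lam k / (k : ℝ) ^ (1 - (α + β))) (Ici 1))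
    (hlim : Tendsto (fun k : ℕ => lam k / (k : ℝ) ^ (1 - (α + β))) atTop (𝓝 0))
    (hsum : Summable fun k : ℕ => lam (k + 1) / ((k + 1 : ℕ) : ℝ) ^ (2 - (α + β)))
    (f : ℝ × ℝ → ℝ) (hper : PartialVariation.Periodic2 f)
    (hint : IntegrableOn f PartialVariation.square)
    (hf : PartialVariation.BoundedPartialVar lam f) :
    (∀ x y Lpp Lpm Lmp Lmm : ℝ,
      Tendsto f (𝓝[>] x ×ˢ 𝓝[>] y) (𝓝 Lpp) →
      Tendsto f (𝓝[>] x ×ˢ 𝓝[<] y) (𝓝 Lpm) →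
      Tendsto f (𝓝[<] x ×ˢ 𝓝[>] y) (𝓝 Lmp) →
      Tendsto f (𝓝[<] x ×ˢ 𝓝[<] y) (𝓝 Lmm) →
      PartialVariation.CesaroSummable (-α) (-β) f (x, y) ((Lpp + Lpm + Lmp + Lmm) / 4)) ∧
    (∀ K : Set (ℝ × ℝ), IsCompact K → (∀ p ∈ K, ContinuousAt f p) →
      PartialVariation.CesaroSummableUniformlyOn (-α) (-β) f K) := by
  refine ⟨fun x y Lpp Lpm Lmp Lmm hpp hpm hmp hmm => ?_, fun K hK hcont =>
    cesaroSummableUniformlyOn_of_continuousAt hα hβ hαβ hpos hanti hsum hper hint hf hK hcont⟩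
  let L (σ τ : ℤˣ) : ℝ :=
    if σ = 1 then (if τ = 1 then Lpp else Lpm) else (if τ = 1 then Lmp else Lmm)
  have hsumL : ∑ σ, ∑ τ, L σ τ = Lpp + Lpm + Lmp + Lmm := by
    simp [L, UnitsInt.univ, add_assoc]
  rw [← hsumL]
  refine cesaroSummable_of_tendsto_quadrants hα hβ hαβ hpos hanti hsum hper hint hf
    fun σ τ => ?_
  have hx := tendsto_add_nhdsGT x
  have hx' := tendsto_sub_nhdsGT x
  have hy := tendsto_add_nhdsGT y
  have hy' := tendsto_sub_nhdsGT y
  rcases Int.units_eq_one_or σ with rfl | rfl <;> rcases Int.units_eq_one_or τ with rfl | rfl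
  · simpa [L, Function.comp_def, Prod.map_def, sub_eq_add_neg] using hpp.comp (hx.prodMap hy)
  · simpa [L, Function.comp_def, Prod.map_def, sub_eq_add_neg] using hpm.comp (hx.prodMap hy')
  · simpa [L, Function.comp_def, Prod.map_def, sub_eq_add_neg] using hmp.comp (hx'.prodMap hy)
  · simpa [L, Function.comp_def, Prod.map_def, sub_eq_add_neg] using hmm.comp (hx'.prodMap hy')
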